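/- Let $\mathcal A=\{u+\sigma v: u,v\in\mathbb R\}$, $\sigma^2=1$, be the Lorentz numbers, $\mathcal A_{\mathbb C}=\mathcal A\otimes\mathbb C$, $\mathbb H^{\mathcal A_{\mathbb C}}$ the quaternions (units $1,I,J,K$) over $\mathcal A_{\mathbb C}$, $\overline{\,\cdot\,}$ the quaternionic conjugation and $\widehat{\,\cdot\,}$ the map $\sigma\mapsto-\sigma$ applied to all coefficients. Put $$\mathbb H_0=\{p_01+ip_1I+p_2J+ip_3K:\ p_j\in\mathcal A\},\qquad H(\zeta,\zeta')=\sum_j\zeta_j\zeta'_j ,$$ and identify $\mathbb R^{2,2}$ (metric $-dx_0^2+dx_1^2-dx_2^2+dx_3^2$) with $\{\sigma i x_0 1+x_1I+ix_2J+x_3K:\ x_j\in\mathbb R\}$. Set $\mathbb R^{1,2}=(\sigma i1)^\perp$ and $\mathbb R^{2,1}=I^\perp$ in $\mathbb R^{2,2}$. Let $(M,g)$ be a simply connected smooth Lorentzian surface and $E\to M$ a rank $2$ vector bundle with a Lorentzian fibre metric and a compatible connection; $M$ and $E$ are oriented in space and in time, with given spin structures $\tilde Q_M,\tilde Q_E$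 (with structure groups $\{\pm(\cosh u+i\sinh u\,I)\}$ and $\{\pm(\cosh v+\sigma i\sinh v\,I)\}$, $u,v\in\mathbb R$). Let $\Sigma=\Sigma E\otimes\Sigma M$ be the twisted spinor bundle, i.e. the bundle associated to $\tilde Q_E\times_M\tilde Q_M$ and to the action of the product of the structure groups on $\mathbb H_0$ by left multiplication, with its spinorial connection $\nabla$ induced by the connection of $E$ and the Levi-Civita connection of $M$. Denote by $[\varphi]\in\mathbb H_0$ the components of a spinor $\varphi$ in a spin frame. For $X\in E\oplus TM$ with coordinates $(x_0,x_1,x_2,x_3)$ in the orthonormal frame $(e_0,e_1,e_2,e_3)$ of $E\oplus TM$ below the spin frame, put $[X]=\sigma i x_01+x_1I+ix_2J+x_3K$. Then the Clifford action is $[X\cdot\varphi]=\sigma i\,[X]\,\widehat{[\varphi]}$; moreover $H(\varphi,\varphi)=H([\varphi],[\varphi])$, $\langle\langle\psi,\psi'\rangle\rangle=\sigma i\,\overline{[\psi']}\,[\psi]$, and $[\beta(\varphi)]=i\sigma[\varphi]I$ defines a real structure $\beta$ on $\Sigma$. The Dirac operator is $D\varphi=-e_2\cdot\nabla_{e_2}\varphi+e_3\cdot\nabla_{e_3}\varphi$,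 where $(e_2,e_3)$ is a local orthonormal frame of $TM$ with $|e_2|^2=-1$, $|e_3|^2=1$. Let $\vec H$ be a smooth section of $E$, let $\varphi\in\Gamma(\Sigma)$ satisfy $D\varphi=\vec H\cdot\varphi$ and $H(\varphi,\varphi)=1$, and let $F:M\to\mathbb R^{2,2}$ be the immersion (unique up to translations) defined by $\varphi$, i.e. a smooth map with $dF(X)=\langle\langle X\cdot\varphi,\varphi\rangle\rangle$ for all $X\in TM$. By a parallel orthonormal frame of $E$ we mean a pair $(e_0,e_1)$ of smooth, orthogonal, parallel global sections of $E$ with $\langle e_0,e_0\rangle=-1$ and $\langle e_1,e_1\rangle=1$ ($E$ is flat if such a frame exists); no condition on its orientation is imposed. Then: 1. If, for some parallel orthonormal frame $(e_0,e_1)$ of $E$, $\vec H=h\,e_1$ for a function $h:M\to\mathbb R$ and $e_0\cdot\varphi=\varphi$, then, up to a translation of $\mathbb R^{2,2}$, $F$ takes its values in $\mathbb R^{1,2}$. 2. If, for some parallel orthonormal frame $(e_0,e_1)$ of $E$, $\vec H=h\,e_0$ for a function $h:M\to\mathbb R$ and $e_1\cdot\varphi=-\beta(\varphi)$, then, up to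 a translation of $\mathbb R^{2,2}$, $F$ takes its values in $\mathbb R^{2,1}$. 3. Conversely, if up to a translation $F$ takes its values in $\mathbb R^{1,2}$ (resp. in $\mathbb R^{2,1}$), then $E$ is flat and there is a parallel orthonormal frame $(e_0,e_1)$ of $E$ such that $\vec H=h\,e_1$ for a function $h$ and $e_0\cdot\varphi=\varphi$ (resp. $\vec H=h\,e_0$ for a function $h$ and $e_1\cdot\varphi=-\beta(\varphi)$). -/

import Mathlib

open Bundle
open scoped Manifold ContDiff Topology Quaternion

noncomputable section

/-! ### The algebra: Lorentz numbers, quaternions, the space `ℝ^{2,2}` -/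

/-- The Lorentz numbers `u + σ v`, `u v : ℝ`, `σ² = 1`. -/
abbrev LorentzNumber : Type := QuadraticAlgebra ℝ 1 0

/-- The complexified Lorentz numbers `u + σ v`, `u v : ℂ`, `σ² = 1`. -/
abbrev ComplexLorentzNumber : Type := QuadraticAlgebra ℂ 1 0

/-- The quaternions over the complexified Lorentz numbers
(`I² = J² = K² = -1`, `IJ = -JI = K`, all coefficients central). -/
abbrev LorentzQuaternion : Type := QuaternionAlgebra ComplexLorentzNumber (-1) 0 (-1)

namespace LorentzSpin

/-- The inclusion of the Lorentz numbers in the complexified Lorentz numbers. -/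
def ofLorentz (a : LorentzNumber) : ComplexLorentzNumber := ⟨(a.re : ℂ), (a.im : ℂ)⟩

/-- The scalar `σ`. -/
def sigma : ComplexLorentzNumber := ⟨0, 1⟩

/-- The scalar `i`. -/
def imag : ComplexLorentzNumber := ⟨Complex.I, 0⟩

/-- `u + σ v ↦ u - σ v` on complexified Lorentz numbers. -/
def hatScalar (a : ComplexLorentzNumber) : ComplexLorentzNumber := ⟨a.re, -a.im⟩

/-- The hat map on quaternions, coefficient by coefficient. -/
def hat (q : LorentzQuaternion) : LorentzQuaternion :=
  ⟨hatScalar q.re, hatScalar q.imI, hatScalar q.imJ, hatScalar q.imK⟩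

/-- The conjugation `ζ₀ + ζ₁I + ζ₂J + ζ₃K ↦ ζ₀ - ζ₁I - ζ₂J - ζ₃K`. -/
def conj (q : LorentzQuaternion) : LorentzQuaternion := ⟨q.re, -q.imI, -q.imJ, -q.imK⟩

/-- The vectors `σi1`, `I`, `iJ`, `K` representing `e₀, e₁, e₂, e₃`. -/
def gen : Fin 4 → LorentzQuaternion :=
  ![⟨sigma * imag, 0, 0, 0⟩, ⟨0, 1, 0, 0⟩, ⟨0, 0, imag, 0⟩, ⟨0, 0, 0, 1⟩]

/-- The identification of `ℝ^{2,2}` with the real span of `σi1, I, iJ, K`. -/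
def vec (x : Fin 4 → ℝ) : LorentzQuaternion := ∑ j, x j • gen j

/-- The metric `-x₀y₀ + x₁y₁ - x₂y₂ + x₃y₃` of `ℝ^{2,2}`. -/
def form22 (x y : Fin 4 → ℝ) : ℝ := -(x 0 * y 0) + x 1 * y 1 - x 2 * y 2 + x 3 * y 3

/-- `ℍ₀`: the elements `p₀ + i p₁ I + p₂ J + i p₃ K` with `p₀, p₁, p₂, p₃` Lorentz numbers. -/
def H0 : Set LorentzQuaternion :=
  {q | ∃ p : Fin 4 → LorentzNumber,
    q = ⟨ofLorentz (p 0), imag * ofLorentz (p 1), ofLorentz (p 2), imag * ofLorentz (p 3)⟩}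

/-- The bilinear map `H(ζ, ζ') = ζ₀ζ₀' + ζ₁ζ₁' + ζ₂ζ₂' + ζ₃ζ₃'`. -/
def Hform (q q' : LorentzQuaternion) : ComplexLorentzNumber :=
  q.re * q'.re + q.imI * q'.imI + q.imJ * q'.imJ + q.imK * q'.imK

/-- The scalar `σi`, as a quaternion. -/
def sigmaI : LorentzQuaternion := ⟨sigma * imag, 0, 0, 0⟩

/-- The Clifford action on `ℍ₀` of an element of degree one represented by `y`:
`ξ ↦ σ i y ξ̂`. -/
def cliff (y ξ : LorentzQuaternion) : LorentzQuaternion := sigmaI * y * hat ξ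

/-- The `ℍ₁`-valued pairing `⟪⟪ψ, ψ'⟫⟫ = σ i (conj ξ') ξ`, in components. -/
def pairing (ξ ξ' : LorentzQuaternion) : LorentzQuaternion := sigmaI * conj ξ' * ξ

/-- The real structure `β(ξ) = i σ ξ I`. -/
def beta (ξ : LorentzQuaternion) : LorentzQuaternion := sigmaI * ξ * gen 1

/-- The complex coordinates of a quaternion, used to differentiate quaternion-valued maps. -/
def toCoord (q : LorentzQuaternion) : Fin 4 → Fin 2 → ℂ :=
  ![![q.re.re, q.re.im], ![q.imI.re, q.imI.im], ![q.imJ.re, q.imJ.im], ![q.imK.re, q.imK.im]]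

/-- The quaternion with given complex coordinates. -/
def ofCoord (c : Fin 4 → Fin 2 → ℂ) : LorentzQuaternion :=
  ⟨⟨c 0 0, c 0 1⟩, ⟨c 1 0, c 1 1⟩, ⟨c 2 0, c 2 1⟩, ⟨c 3 0, c 3 1⟩⟩

/-- The quaternion `iI`. -/
def iI : LorentzQuaternion := ⟨0, imag, 0, 0⟩

/-- The group `Spin(1,1) = {± e^t}`, as the pairs (sign, `t`). -/
abbrev Spin11 : Type := ℤˣ × Multiplicative ℝ

/-- The sign of an element of `Spin(1,1)`. -/
def Spin11.sign (a : Spin11) : ℝ := ((a.1 : ℤ) : ℝ)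

/-- The real parameter of an element of `Spin(1,1)`. -/
def Spin11.param (a : Spin11) : ℝ := Multiplicative.toAdd a.2

/-- The embedding `±(cosh v + σ i sinh v I)` of the `Spin(1,1)`-factor acting on the plane
`(e₀, e₁)`. -/
def spinNormal (a : Spin11) : LorentzQuaternion :=
  a.sign • (Real.cosh a.param • (1 : LorentzQuaternion) +
    Real.sinh a.param • (sigmaI * gen 1))

/-- The embedding `±(cosh u + i sinh u I)` of the `Spin(1,1)`-factor acting on the plane
`(e₂, e₃)`. -/
def spinTangent (a : Spin11) : LorentzQuaternion :=
  a.sign • (Real.cosh a.param • (1 : LorentzQuaternion) +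
    Real.sinh a.param • iI)

/-! ### Lorentzian bundles of rank two over a surface -/

/-- The model plane. -/
abbrev Plane : Type := EuclideanSpace ℝ (Fin 2)

section Bundles

variable {M : Type*} [TopologicalSpace M] [ChartedSpace Plane M]

/-- The section `s` of a rank two bundle is smooth on `U`. -/
def SmoothSectionOn {V : M → Type*} [TopologicalSpace (TotalSpace Plane V)]
    [∀ x, TopologicalSpace (V x)] [FiberBundle Plane V] (s : ∀ x, V x) (U : Set M) : Prop :=
  ContMDiffOn 𝓘(ℝ, Plane) (𝓘(ℝ, Plane).prod 𝓘(ℝ, Plane)) ∞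
    (fun x ↦ TotalSpace.mk' Plane x (s x)) U

/-- A smooth fibre metric of signature `(1,1)` on a rank two bundle `V`. -/
structure LorentzMetric (V : M → Type*) [TopologicalSpace (TotalSpace Plane V)]
    [∀ x, TopologicalSpace (V x)] [∀ x, AddCommGroup (V x)] [∀ x, Module ℝ (V x)]
    [∀ x, IsTopologicalAddGroup (V x)] [∀ x, ContinuousSMul ℝ (V x)]
    [FiberBundle Plane V] [VectorBundle ℝ Plane V] where
  inner : ∀ x, V x →L[ℝ] V x →L[ℝ] ℝ
  symm : ∀ x (v w : V x), inner x v w = inner x w v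
  signature : ∀ x, ∃ u v : V x, inner x u u = -1 ∧ inner x v v = 1 ∧ inner x u v = 0
  contMDiff : ContMDiff 𝓘(ℝ, Plane) (𝓘(ℝ, Plane).prod 𝓘(ℝ, Plane →L[ℝ] Plane →L[ℝ] ℝ)) ∞
    (fun x ↦ TotalSpace.mk' (Plane →L[ℝ] Plane →L[ℝ] ℝ) x (inner x))

variable {V : M → Type*} [TopologicalSpace (TotalSpace Plane V)]
  [∀ x, TopologicalSpace (V x)] [∀ x, AddCommGroup (V x)] [∀ x, Module ℝ (V x)]
  [∀ x, IsTopologicalAddGroup (V x)] [∀ x, ContinuousSMul ℝ (V x)]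
  [FiberBundle Plane V] [VectorBundle ℝ Plane V]

/-- `(u, v)` is an orthonormal basis of `V x` with `u` timelike and `v` spacelike. -/
def LorentzMetric.IsOrthonormal (g : LorentzMetric V) (x : M) (u v : V x) : Prop :=
  g.inner x u u = -1 ∧ g.inner x v v = 1 ∧ g.inner x u v = 0

/-- Given an orientation `o` and a family `future` of sets of vectors: `(u, v)` is an orthonormal
basis of `V x`, with `u` timelike and future-directed, which has the orientation of `V x`. -/
def LorentzMetric.IsPositive (g : LorentzMetric V) (o : ∀ x, Orientation ℝ (V x) (Fin 2))
    (future : ∀ x, Set (V x)) (x : M) (u v : V x) : Prop :=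
  g.IsOrthonormal x u v ∧ u ∈ future x ∧
    ∃ b : Module.Basis (Fin 2) ℝ (V x), b 0 = u ∧ b 1 = v ∧ b.orientation = o x

/-- An orientation in space and in time of a Lorentzian plane bundle: an orientation of the fibres
and a component of the cone of timelike vectors in each fibre, both continuous in the base
point. -/
structure SpaceTimeOrientation (g : LorentzMetric V) where
  orientation : ∀ x, Orientation ℝ (V x) (Fin 2)
  future : ∀ x, Set (V x)
  isTimeCone : ∀ x, ∃ t, g.inner x t t < 0 ∧
    future x = {w | g.inner x w w < 0 ∧ g.inner x w t < 0}
  locally_frame : ∀ x, ∃ U : Set M, IsOpen U ∧ x ∈ U ∧ ∃ u v : ∀ y, V y,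
    SmoothSectionOn u U ∧ SmoothSectionOn v U ∧
      ∀ y ∈ U, g.IsPositive orientation future y (u y) (v y)

/-- The bundle of positively oriented (in space and in time) orthonormal frames, with the topology
induced by the total space of `V ⊕ V`. -/
def FrameBundle {g : LorentzMetric V} (o : SpaceTimeOrientation g) : Type _ :=
  {p : TotalSpace (Plane × Plane) (V ×ᵇ V) //
    g.IsPositive o.orientation o.future p.proj p.2.1 p.2.2}

instance {g : LorentzMetric V} (o : SpaceTimeOrientation g) : TopologicalSpace (FrameBundle o) :=
  inferInstanceAs (TopologicalSpace {p : TotalSpace (Plane × Plane) (V ×ᵇ V) //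
    g.IsPositive o.orientation o.future p.proj p.2.1 p.2.2})

/-- A spin structure with total space `P`: a principal `Spin(1,1)`-bundle which covers the frame
bundle, equivariantly with respect to the double cover `Spin(1,1) → SO(1,1)` sending `± e^t` to the
Lorentz rotation of angle `-2t`. -/
structure SpinStructure {g : LorentzMetric V} (o : SpaceTimeOrientation g)
    (P : Type*) [TopologicalSpace P] [MulAction Spin11 P] where
  proj : P → FrameBundle o
  isCoveringMap : IsCoveringMap proj
  surjective : Function.Surjective proj
  continuous_action : Continuous (fun z : Spin11 × P ↦ z.1 • z.2)
  simply_transitive : ∀ p q : P, (proj p).1.proj = (proj q).1.proj → ∃! a : Spin11, a • p = q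
  equivariant : ∀ (a : Spin11) (p : P), (proj (a • p)).1 =
    ⟨(proj p).1.proj,
      (Real.cosh (2 * a.param) • (proj p).1.2.1 - Real.sinh (2 * a.param) • (proj p).1.2.2,
        -(Real.sinh (2 * a.param) • (proj p).1.2.1) + Real.cosh (2 * a.param) • (proj p).1.2.2)⟩

namespace SpinStructure

variable {g : LorentzMetric V} {o : SpaceTimeOrientation g}
  {P : Type*} [TopologicalSpace P] [MulAction Spin11 P]

/-- The base point of a spin frame. -/
def base (S : SpinStructure o P) (p : P) : M := (S.proj p).1.proj

/-- The timelike vector of the frame below a spin frame. -/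
def vecT (S : SpinStructure o P) (p : P) : V (S.base p) := (S.proj p).1.2.1

/-- The spacelike vector of the frame below a spin frame. -/
def vecS (S : SpinStructure o P) (p : P) : V (S.base p) := (S.proj p).1.2.2

/-- The coordinates of a vector in the orthonormal frame below a spin frame. -/
def coord (S : SpinStructure o P) (p : P) (w : V (S.base p)) : ℝ × ℝ :=
  (-(g.inner _ w (S.vecT p)), g.inner _ w (S.vecS p))

/-- A local section `lift` of the spin structure over the open set `U`, above a smooth orthonormal
frame `(timelike, spacelike)`. The values outside `U` play no role. -/
structure LocalFrame (S : SpinStructure o P) (U : Set M) where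
  isOpen : IsOpen U
  lift : M → P
  timelike : ∀ x, V x
  spacelike : ∀ x, V x
  continuousOn_lift : ContinuousOn lift U
  smooth_timelike : SmoothSectionOn timelike U
  smooth_spacelike : SmoothSectionOn spacelike U
  proj_lift : ∀ x ∈ U, (S.proj (lift x)).1 = ⟨x, (timelike x, spacelike x)⟩

end SpinStructure

/-- A connection on `V` is compatible with the fibre metric:
`X⟨s, t⟩ = ⟨∇_X s, t⟩ + ⟨s, ∇_X t⟩` at each point where the sections `s, t` are differentiable. -/
def LorentzMetric.IsCompatible (g : LorentzMetric V)
    (cov : CovariantDerivative 𝓘(ℝ, Plane) Plane V) : Prop :=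
  ∀ (s t : ∀ x, V x) (x : M),
    MDifferentiableAt 𝓘(ℝ, Plane) (𝓘(ℝ, Plane).prod 𝓘(ℝ, Plane))
      (fun y ↦ TotalSpace.mk' Plane y (s y)) x →
    MDifferentiableAt 𝓘(ℝ, Plane) (𝓘(ℝ, Plane).prod 𝓘(ℝ, Plane))
      (fun y ↦ TotalSpace.mk' Plane y (t y)) x →
    ∀ X : TangentSpace 𝓘(ℝ, Plane) x,
      mvfderiv 𝓘(ℝ, Plane) (fun y ↦ g.inner y (s y) (t y)) x X =
        g.inner x (cov s x X) (t x) + g.inner x (s x) (cov t x X)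

end Bundles

/-! ### Spinors on a Lorentzian surface, twisted by a Lorentzian bundle -/

section Surface

variable {M : Type*} [TopologicalSpace M] [ChartedSpace Plane M] [IsManifold 𝓘(ℝ, Plane) ∞ M]

/-- The tangent spaces of the surface. -/
abbrev TM (M : Type*) [TopologicalSpace M] [ChartedSpace Plane M] (x : M) : Type :=
  TangentSpace 𝓘(ℝ, Plane) x

/-- `⟨∇_X Y, Z⟩` for the Levi-Civita connection `∇` of the metric `g`, by the Koszul formula. -/
def leviCivita (g : LorentzMetric (TM M)) (X Y Z : ∀ x, TM M x) (x : M) : ℝ :=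
  (1 / 2) *
    (mvfderiv 𝓘(ℝ, Plane) (fun y ↦ g.inner y (Y y) (Z y)) x (X x)
      + mvfderiv 𝓘(ℝ, Plane) (fun y ↦ g.inner y (X y) (Z y)) x (Y x)
      - mvfderiv 𝓘(ℝ, Plane) (fun y ↦ g.inner y (X y) (Y y)) x (Z x)
      + g.inner x (VectorField.mlieBracket 𝓘(ℝ, Plane) X Y x) (Z x)
      - g.inner x (VectorField.mlieBracket 𝓘(ℝ, Plane) X Z x) (Y x)
      - g.inner x (VectorField.mlieBracket 𝓘(ℝ, Plane) Y Z x) (X x))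

/-- The connection form `⟨∇_X e₂, e₃⟩` of the Levi-Civita connection, in a local orthonormal frame
`(e₂, e₃)`, where `X = -⟨X, e₂⟩ e₂ + ⟨X, e₃⟩ e₃`. -/
def tangentForm (g : LorentzMetric (TM M)) (e₂ e₃ : ∀ x, TM M x) (x : M) (X : TM M x) : ℝ :=
  -(g.inner x X (e₂ x)) * leviCivita g e₂ e₂ e₃ x + g.inner x X (e₃ x) * leviCivita g e₃ e₂ e₃ x

variable {E : M → Type*} [TopologicalSpace (TotalSpace Plane E)]
  [∀ x, TopologicalSpace (E x)] [∀ x, AddCommGroup (E x)] [∀ x, Module ℝ (E x)]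
  [∀ x, IsTopologicalAddGroup (E x)] [∀ x, ContinuousSMul ℝ (E x)]
  [FiberBundle Plane E] [VectorBundle ℝ Plane E]

/-- The connection form `⟨∇_X e₀, e₁⟩` of the connection of `E` in a local orthonormal frame
`(e₀, e₁)`. -/
def normalForm (gE : LorentzMetric E) (cov : CovariantDerivative 𝓘(ℝ, Plane) Plane E)
    (e₀ e₁ : ∀ x, E x) (x : M) (X : TM M x) : ℝ :=
  gE.inner x (cov e₀ x X) (e₁ x)

variable {gE : LorentzMetric E} {oE : SpaceTimeOrientation gE}
  {gM : LorentzMetric (TM M)} {oM : SpaceTimeOrientation gM}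
  {PE PM : Type*} [TopologicalSpace PE] [MulAction Spin11 PE]
  [TopologicalSpace PM] [MulAction Spin11 PM]

/-- A smooth spinor field, section of the twisted spinor bundle `Σ` associated to the principal
bundle `PE ×_M PM` and to the representation `g ↦ (ξ ↦ g ξ)` of `Spin(1,1) × Spin(1,1)` on `ℍ₀`:
an equivariant map from `PE ×_M PM` to `ℍ₀`, sending a spin frame to the components of the spinor
in this frame. The values of `comp` at pairs with different base points play no role. -/
structure SpinorField (SE : SpinStructure oE PE) (SM : SpinStructure oM PM) where
  comp : PE → PM → LorentzQuaternion
  mem_H0 : ∀ p q, SE.base p = SM.base q → comp p q ∈ H0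
  equivariant : ∀ (a b : Spin11) (p : PE) (q : PM), SE.base p = SM.base q →
    comp (a • p) (b • q) = spinNormal a⁻¹ * spinTangent b⁻¹ * comp p q
  smooth : ∀ (U : Set M) (s : SE.LocalFrame U) (t : SM.LocalFrame U),
    ContMDiffOn 𝓘(ℝ, Plane) 𝓘(ℝ, Fin 4 → Fin 2 → ℂ) ∞
      (fun x ↦ toCoord (comp (s.lift x) (t.lift x))) U

/-- The element of degree one representing `w ∈ E` in a spin frame. -/
def repE (SE : SpinStructure oE PE) (p : PE) (w : E (SE.base p)) : LorentzQuaternion :=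
  vec ![(SE.coord p w).1, (SE.coord p w).2, 0, 0]

/-- The element of degree one representing `X ∈ TM` in a spin frame. -/
def repM (SM : SpinStructure oM PM) (q : PM) (X : TM M (SM.base q)) : LorentzQuaternion :=
  vec ![0, 0, (SM.coord q X).1, (SM.coord q X).2]

namespace SpinorField

variable {SE : SpinStructure oE PE} {SM : SpinStructure oM PM}

/-- The components in the spin frame `(s, t)` of the covariant derivative `∇_X φ`, for the spinorial
connection induced by the connection of `E` and the Levi-Civita connection of `M`:
`X[φ] + ½ ∑_{i<j} εᵢ εⱼ ⟨∇_X eᵢ, eⱼ⟩ eᵢ · eⱼ · [φ]`, the sum being over `(i,j) = (0,1), (2,3)`. -/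
def nabla (φ : SpinorField SE SM) (cov : CovariantDerivative 𝓘(ℝ, Plane) Plane E) {U : Set M}
    (s : SE.LocalFrame U) (t : SM.LocalFrame U) (x : M) (X : TM M x) : LorentzQuaternion :=
  ofCoord (mvfderiv 𝓘(ℝ, Plane) (fun y ↦ toCoord (φ.comp (s.lift y) (t.lift y))) x X)
    - (1 / 2 * normalForm gE cov s.timelike s.spacelike x X) •
        cliff (gen 0) (cliff (gen 1) (φ.comp (s.lift x) (t.lift x)))
    - (1 / 2 * tangentForm gM t.timelike t.spacelike x X) •
        cliff (gen 2) (cliff (gen 3) (φ.comp (s.lift x) (t.lift x)))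

/-- The components in the spin frame `(s, t)` of `Dφ = -e₂·∇_{e₂}φ + e₃·∇_{e₃}φ`. -/
def dirac (φ : SpinorField SE SM) (cov : CovariantDerivative 𝓘(ℝ, Plane) Plane E) {U : Set M}
    (s : SE.LocalFrame U) (t : SM.LocalFrame U) (x : M) : LorentzQuaternion :=
  -(cliff (gen 2) (φ.nabla cov s t x (t.timelike x)))
    + cliff (gen 3) (φ.nabla cov s t x (t.spacelike x))

/-- The Dirac equation `Dφ = N·φ`, for a section `N` of `E`. -/
def IsDiracSolution (φ : SpinorField SE SM) (cov : CovariantDerivative 𝓘(ℝ, Plane) Plane E)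
    (N : ∀ x, E x) : Prop :=
  ∀ (U : Set M) (s : SE.LocalFrame U) (t : SM.LocalFrame U), ∀ x ∈ U,
    φ.dirac cov s t x =
      cliff (repE SE (s.lift x) (N (SE.base (s.lift x)))) (φ.comp (s.lift x) (t.lift x))

/-- The normalisation `H(φ, φ) = 1`. -/
def IsNormalised (φ : SpinorField SE SM) : Prop :=
  ∀ p q, SE.base p = SM.base q → Hform (φ.comp p q) (φ.comp p q) = 1

/-- The pointwise identity `ν · φ = φ`, for a section `ν` of `E`. -/
def FixedBy (φ : SpinorField SE SM) (ν : ∀ x, E x) : Prop :=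
  ∀ p q, SE.base p = SM.base q →
    cliff (repE SE p (ν (SE.base p))) (φ.comp p q) = φ.comp p q

/-- The pointwise identity `ν · φ = -β(φ)`, for a section `ν` of `E`. -/
def NegBetaBy (φ : SpinorField SE SM) (ν : ∀ x, E x) : Prop :=
  ∀ p q, SE.base p = SM.base q →
    cliff (repE SE p (ν (SE.base p))) (φ.comp p q) = -beta (φ.comp p q)

/-- `F` is a smooth map `M → ℝ^{2,2}` with `dF(X) = ξ(X) = ⟪⟪X · φ, φ⟫⟫` for all `X ∈ TM`, i.e. the
immersion (unique up to translations) defined by `φ`. -/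
def IsImmersionOf (φ : SpinorField SE SM) (F : M → Fin 4 → ℝ) : Prop :=
  ContMDiff 𝓘(ℝ, Plane) 𝓘(ℝ, Fin 4 → ℝ) ∞ F ∧
    ∀ p q, SE.base p = SM.base q → ∀ X : TM M (SM.base q),
      vec (mvfderiv 𝓘(ℝ, Plane) F (SM.base q) X) =
        pairing (cliff (repM SM q X) (φ.comp p q)) (φ.comp p q)

end SpinorField

/-- `(e₀, e₁)` are smooth, unit, orthogonal and parallel sections of `E`, with `e₀` timelike and
`e₁` spacelike. -/
def IsParallelFrame (gE : LorentzMetric E) (cov : CovariantDerivative 𝓘(ℝ, Plane) Plane E)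
    (e₀ e₁ : ∀ x, E x) : Prop :=
  SmoothSectionOn e₀ Set.univ ∧ SmoothSectionOn e₁ Set.univ ∧
    (∀ x, gE.IsOrthonormal x (e₀ x) (e₁ x)) ∧ (∀ x, cov e₀ x = 0) ∧ (∀ x, cov e₁ x = 0)

end Surface

/-- `ℝ^{1,2} = (σi1)^⊥` in `ℝ^{2,2}`. -/
def R12 : Set (Fin 4 → ℝ) := {x | form22 x (Pi.single 0 1) = 0}

/-- `ℝ^{2,1} = I^⊥` in `ℝ^{2,2}`. -/
def R21 : Set (Fin 4 → ℝ) := {x | form22 x (Pi.single 1 1) = 0}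

/-- Up to a translation of `ℝ^{2,2}`, the map `F` takes its values in `W`. -/
def LiesIn {M : Type*} (F : M → Fin 4 → ℝ) (W : Set (Fin 4 → ℝ)) : Prop :=
  ∃ c : Fin 4 → ℝ, ∀ x, F x - c ∈ W

end LorentzSpin

end

noncomputable section

namespace LorentzSpin

set_option linter.unusedSectionVars false

/-! Let C be σi1 or I, and attach to a spinor with components f the element `lift C f` = -f C
conj(f̂). Since ⟪⟪X·φ, φ⟫⟫ = -conj(f) [X] f̂, moving f across the bilinear form H gives H(dF(X), C)
= H([X], `lift C f`) (`Hform_pairing`). So the C-coordinate of F is constant on the connected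
surface exactly when `lift C f` has no tangential part, i.e. represents a vector of E. On the other
hand f is a unit, so e₀·φ = φ says that e₀ is represented by `lift (gen 0) f`, and e₁·φ = -β(φ) that
e₁ is represented by `lift (gen 1) f` (`cliff_eq_self_iff`, `cliff_eq_neg_beta_iff`). This gives the
direct statements.

For the converse, `lift C f` transforms like a vector under a change of spin frame and defines a
section ν of E; one has to show that ν is parallel and orthogonal to the mean curvature vector
(`exists_parallel`). Put e = (∇_X φ) conj(f). Differentiating H(φ, φ) = 1 shows that e has no real
part (`mul_conj_anti`). The Dirac equation has a normal right-hand side, which forces the I-part of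
e to vanish for X = e₂ and X = e₃ (`dirac_components`). The contribution of e to the derivative of ν
(`lift_deriv`) is then tangential, whereas ν stays normal: this contribution vanishes, only the
connection form of E remains, and ν is parallel (`parallel_coeffs`). The vanishing of the
contribution, combined with the other components of the Dirac equation, also gives orthogonality
(`form_eq_zero_of_coeffs`).

Finally ⟨ν, ν⟩ = H(C, C) = ∓1 by `Hform_lift`, and exchanging the two coordinates of ν gives the
other vector of a parallel orthonormal frame. -/

/-! ### Quaternionic conjugation, the hat map and the form H -/

lemma Hform_conj_mul (f Z g C : LorentzQuaternion) :
    Hform (conj f * Z * g) C = Hform Z (f * C * conj g) := by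
  simp only [Hform, conj, QuaternionAlgebra.re_mul, QuaternionAlgebra.imI_mul,
    QuaternionAlgebra.imJ_mul, QuaternionAlgebra.imK_mul]
  ring

lemma Hform_neg_left (f g : LorentzQuaternion) : Hform (-f) g = -Hform f g := by
  simp only [Hform, QuaternionAlgebra.re_neg, QuaternionAlgebra.imI_neg, QuaternionAlgebra.imJ_neg,
    QuaternionAlgebra.imK_neg]
  ring

lemma Hform_neg_right (f g : LorentzQuaternion) : Hform f (-g) = -Hform f g := by
  simp only [Hform, QuaternionAlgebra.re_neg, QuaternionAlgebra.imI_neg, QuaternionAlgebra.imJ_neg,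
    QuaternionAlgebra.imK_neg]
  ring

lemma mul_conj (f : LorentzQuaternion) : f * conj f = ⟨Hform f f, 0, 0, 0⟩ := by
  ext1 <;> simp only [Hform, conj, QuaternionAlgebra.re_mul, QuaternionAlgebra.imI_mul,
    QuaternionAlgebra.imJ_mul, QuaternionAlgebra.imK_mul] <;> ring

lemma conj_mul (f : LorentzQuaternion) : conj f * f = ⟨Hform f f, 0, 0, 0⟩ := by
  ext1 <;> simp only [Hform, conj, QuaternionAlgebra.re_mul, QuaternionAlgebra.imI_mul,
    QuaternionAlgebra.imJ_mul, QuaternionAlgebra.imK_mul] <;> ring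

lemma conj_mul_rev (f g : LorentzQuaternion) : conj (f * g) = conj g * conj f := by
  ext1 <;> simp only [conj, QuaternionAlgebra.re_mul, QuaternionAlgebra.imI_mul,
    QuaternionAlgebra.imJ_mul, QuaternionAlgebra.imK_mul] <;> ring

lemma conj_conj (f : LorentzQuaternion) : conj (conj f) = f := by
  ext1 <;> simp [conj]

lemma hat_hat (f : LorentzQuaternion) : hat (hat f) = f := by
  ext <;> simp [hat, hatScalar]

lemma hat_conj (f : LorentzQuaternion) : hat (conj f) = conj (hat f) := by
  ext <;> simp [hat, conj, hatScalar]

lemma hatScalar_mul (a b : ComplexLorentzNumber) :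
    hatScalar (a * b) = hatScalar a * hatScalar b := by
  ext <;> simp [hatScalar] <;> ring

lemma hatScalar_add (a b : ComplexLorentzNumber) :
    hatScalar (a + b) = hatScalar a + hatScalar b := by
  ext <;> simp [hatScalar] <;> ring

lemma hatScalar_neg (a : ComplexLorentzNumber) : hatScalar (-a) = -hatScalar a := by
  ext <;> simp [hatScalar]

lemma hatScalar_zero : hatScalar 0 = 0 := by
  ext <;> simp [hatScalar]

lemma hatScalar_one : hatScalar 1 = 1 := by
  ext <;> simp [hatScalar, QuadraticAlgebra.re_one, QuadraticAlgebra.im_one]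

lemma hat_one : hat 1 = 1 := by
  ext <;> simp [hat, hatScalar, QuadraticAlgebra.re_one, QuadraticAlgebra.im_one]

lemma hat_mul (f g : LorentzQuaternion) : hat (f * g) = hat f * hat g := by
  ext1 <;> simp only [hat, QuaternionAlgebra.re_mul, QuaternionAlgebra.imI_mul,
    QuaternionAlgebra.imJ_mul, QuaternionAlgebra.imK_mul, sub_eq_add_neg, hatScalar_add,
    hatScalar_mul, hatScalar_neg, hatScalar_zero, hatScalar_one]

lemma sigmaI_mul_comm (f : LorentzQuaternion) : f * sigmaI = sigmaI * f := by
  ext1 <;> simp only [sigmaI, QuaternionAlgebra.re_mul, QuaternionAlgebra.imI_mul,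
    QuaternionAlgebra.imJ_mul, QuaternionAlgebra.imK_mul] <;> ring

lemma sigmaI_sq : sigmaI * sigmaI = -1 := by
  ext <;> simp [sigmaI, sigma, imag, QuadraticAlgebra.re_one,
    QuadraticAlgebra.im_one]

lemma hat_sigmaI : hat sigmaI = -sigmaI := by
  ext <;> simp [hat, hatScalar, sigmaI, sigma, imag]

/-- Conjugation as a real linear map. -/
def conjₗ : LorentzQuaternion →ₗ[ℝ] LorentzQuaternion where
  toFun := conj
  map_add' f g := by ext <;> simp [conj] <;> ring
  map_smul' r f := by ext <;> simp [conj]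

/-- The hat map as a real linear map. -/
def hatₗ : LorentzQuaternion →ₗ[ℝ] LorentzQuaternion where
  toFun := hat
  map_add' f g := by ext <;> simp [hat, hatScalar] <;> ring
  map_smul' r f := by ext <;> simp [hat, hatScalar]

/-! ### The vector attached to a spinor and a constant direction -/

/-- The element `-ξ C conj(ξ̂)` of degree one which, applied to a normalised `ξ`, is mapped to `C`
by `X ↦ ⟪⟪X · ξ, ξ⟫⟫`. -/
def lift (C f : LorentzQuaternion) : LorentzQuaternion := -(f * C * conj (hat f))

lemma vec_eq (x : Fin 4 → ℝ) : vec x = ⟨⟨0, x 0 * Complex.I⟩, ⟨x 1, 0⟩, ⟨x 2 * Complex.I, 0⟩,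
    ⟨x 3, 0⟩⟩ := by
  ext <;> simp [vec, Fin.sum_univ_four, gen, sigma, imag, QuadraticAlgebra.re_one,
    QuadraticAlgebra.im_one]

lemma Hform_vec (x y : Fin 4 → ℝ) : Hform (vec x) (vec y) = ⟨(form22 x y : ℂ), 0⟩ := by
  ext <;> simp [Hform, vec_eq, form22] <;> ring_nf <;> simp <;> ring

lemma gen_eq_vec (j : Fin 4) : gen j = vec (Pi.single j 1) := by
  simp [vec]

/-- The adjoint of X ↦ ⟪⟪X·φ, φ⟫⟫ with respect to H is C ↦ `lift C f`; this turns a statement about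
a coordinate of dF into one about a vector in E ⊕ TM. -/
lemma Hform_pairing (f Z C : LorentzQuaternion) :
    Hform (pairing (cliff Z f) f) C = Hform Z (lift C f) := by
  have h : pairing (cliff Z f) f = -(conj f * Z * hat f) := by
    rw [pairing, cliff, mul_assoc sigmaI, ← mul_assoc (conj f), ← mul_assoc (conj f),
      sigmaI_mul_comm, ← mul_assoc, ← mul_assoc, ← mul_assoc, sigmaI_sq]
    simp [mul_assoc]
  rw [h, lift, Hform_neg_left, Hform_neg_right, Hform_conj_mul]

lemma conj_hat_mul_hat {f : LorentzQuaternion} (hf : Hform f f = 1) :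
    conj (hat f) * hat f = 1 := by
  rw [← hat_conj, ← hat_mul, conj_mul, hf]
  exact hat_one

lemma hat_mul_conj_hat {f : LorentzQuaternion} (hf : Hform f f = 1) :
    hat f * conj (hat f) = 1 := by
  rw [← hat_conj, ← hat_mul, mul_conj, hf]
  exact hat_one

lemma mul_conj_of_unit {f : LorentzQuaternion} (hf : Hform f f = 1) : f * conj f = 1 := by
  rw [mul_conj, hf]; rfl

lemma conj_mul_of_unit {f : LorentzQuaternion} (hf : Hform f f = 1) : conj f * f = 1 := by
  rw [conj_mul, hf]; rfl

/-- Because f̂ is invertible with inverse conj(f̂), Clifford multiplication of f determines the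
vector. Both spinorial conditions of the theorem have this shape, with C = σi1 and C = I. -/
lemma cliff_eq_iff {f : LorentzQuaternion} (hf : Hform f f = 1) (y C : LorentzQuaternion) :
    cliff y f = -(sigmaI * f * C) ↔ y = lift C f := by
  have h1 := conj_hat_mul_hat hf
  have h2 := hat_mul_conj_hat hf
  constructor
  · intro h
    have h3 : -(sigmaI * (cliff y f) * conj (hat f)) = y := by
      rw [cliff, ← mul_assoc, ← mul_assoc, sigmaI_sq, mul_assoc, h2]
      simp
    rw [← h3, h, lift, mul_neg, neg_mul, neg_neg, ← mul_assoc, ← mul_assoc, sigmaI_sq]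
    simp [mul_assoc]
  · rintro rfl
    rw [cliff, lift, mul_neg, neg_mul, mul_assoc, mul_assoc (f * C), h1]
    simp [mul_assoc]

lemma cliff_eq_self_iff {f : LorentzQuaternion} (hf : Hform f f = 1) (y : LorentzQuaternion) :
    cliff y f = f ↔ y = lift (gen 0) f := by
  rw [← cliff_eq_iff hf]
  have : gen 0 = sigmaI := rfl
  rw [this, mul_assoc, sigmaI_mul_comm, ← mul_assoc, sigmaI_sq]
  simp

lemma cliff_eq_neg_beta_iff {f : LorentzQuaternion} (hf : Hform f f = 1) (y : LorentzQuaternion) :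
    cliff y f = -beta f ↔ y = lift (gen 1) f := cliff_eq_iff hf y _

/-- The reality conditions defining ℍ₀ make the vector real. The witness is the expansion of -f σi
conj(f̂) in the components of f. -/
lemma exists_lift_gen_zero {f : LorentzQuaternion} (hf : f ∈ H0) :
    ∃ x, lift (gen 0) f = vec x := by
  obtain ⟨p, rfl⟩ := hf
  refine ⟨![-((p 0).re ^ 2 - (p 0).im ^ 2 - (p 1).re ^ 2 + (p 1).im ^ 2 + (p 2).re ^ 2
      - (p 2).im ^ 2 - (p 3).re ^ 2 + (p 3).im ^ 2),
    2 * ((p 1).im * (p 0).re - (p 1).re * (p 0).im + (p 3).im * (p 2).re - (p 3).re * (p 2).im),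
    -2 * ((p 2).im * (p 0).re - (p 2).re * (p 0).im + (p 3).im * (p 1).re - (p 3).re * (p 1).im),
    2 * ((p 3).im * (p 0).re - (p 3).re * (p 0).im + (p 2).im * (p 1).re - (p 2).re * (p 1).im)],
    ?_⟩
  rw [vec_eq]
  ext1 <;> ext1 <;> simp [lift, gen, sigma, imag, hat, hatScalar, conj, ofLorentz] <;> ring_nf <;>
    simp <;> ring

lemma exists_lift_gen_one {f : LorentzQuaternion} (hf : f ∈ H0) :
    ∃ x, lift (gen 1) f = vec x := by
  obtain ⟨p, rfl⟩ := hf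
  refine ⟨![2 * ((p 1).im * (p 0).re - (p 1).re * (p 0).im - (p 3).im * (p 2).re
      + (p 3).re * (p 2).im),
    -((p 0).re ^ 2 - (p 0).im ^ 2 - (p 1).re ^ 2 + (p 1).im ^ 2 - (p 2).re ^ 2
      + (p 2).im ^ 2 + (p 3).re ^ 2 - (p 3).im ^ 2),
    -2 * ((p 1).re * (p 2).re - (p 1).im * (p 2).im + (p 0).re * (p 3).re - (p 0).im * (p 3).im),
    2 * ((p 1).re * (p 3).re - (p 1).im * (p 3).im + (p 0).re * (p 2).re - (p 0).im * (p 2).im)],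
    ?_⟩
  rw [vec_eq]
  ext1 <;> ext1 <;> simp [lift, gen, sigma, imag, hat, hatScalar, conj, ofLorentz] <;> ring_nf <;>
    simp <;> ring

/-- The product of `lift C f` with its conjugate telescopes to the central scalar H(C, C), since f
and f̂ are units. -/
lemma Hform_lift {f : LorentzQuaternion} (hf : Hform f f = 1) (C : LorentzQuaternion) :
    Hform (lift C f) (lift C f) = Hform C C := by
  have h : lift C f * conj (lift C f) = ⟨Hform C C, 0, 0, 0⟩ := by
    have h1 : conj (lift C f) = -(hat f * (conj C * conj f)) := by
      have : conj (-(f * C * conj (hat f))) = -conj (f * C * conj (hat f)) := conjₗ.map_neg _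
      rw [lift, this, conj_mul_rev, conj_mul_rev, conj_conj]
    have h2 : ∀ c : ComplexLorentzNumber, f * ⟨c, 0, 0, 0⟩ = ⟨c, 0, 0, 0⟩ * f := by
      intro c
      ext1 <;> simp [mul_comm]
    rw [h1, lift, neg_mul_neg, mul_assoc, ← mul_assoc (conj (hat f)), conj_hat_mul_hat hf, one_mul,
      mul_assoc, ← mul_assoc C, mul_conj C, ← mul_assoc, h2, mul_assoc, mul_conj_of_unit hf,
      mul_one]
  rw [mul_conj] at h
  exact congrArg QuaternionAlgebra.re h

/-! ### Pointwise algebra of the covariant derivative and of the Dirac equation -/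

lemma cliff_cliff (y z f : LorentzQuaternion) : cliff y (cliff z f) = y * hat z * f := by
  rw [cliff, cliff, hat_mul, hat_mul, hat_hat, hat_sigmaI, mul_assoc sigmaI y, ← mul_assoc y,
    ← mul_assoc y, mul_neg, sigmaI_mul_comm, ← mul_assoc, ← mul_assoc, mul_neg, ← mul_assoc,
    sigmaI_sq]
  simp [mul_assoc]

lemma gen_zero_mul_hat_gen_one : gen 0 * hat (gen 1) = sigmaI * gen 1 := by
  ext <;> simp [gen, sigmaI, hat, hatScalar, sigma, imag, QuadraticAlgebra.re_one,
    QuadraticAlgebra.im_one]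

lemma gen_two_mul_hat_gen_three : gen 2 * hat (gen 3) = iI := by
  ext <;> simp [gen, iI, hat, hatScalar, imag, QuadraticAlgebra.re_one, QuadraticAlgebra.im_one]

lemma conj_neg (f : LorentzQuaternion) : conj (-f) = -conj f := conjₗ.map_neg f
lemma conj_add (f g : LorentzQuaternion) : conj (f + g) = conj f + conj g := conjₗ.map_add f g
lemma conj_smul (r : ℝ) (f : LorentzQuaternion) : conj (r • f) = r • conj f := conjₗ.map_smul r f
lemma hat_add (f g : LorentzQuaternion) : hat (f + g) = hat f + hat g := hatₗ.map_add f g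
lemma hat_smul (r : ℝ) (f : LorentzQuaternion) : hat (r • f) = r • hat f := hatₗ.map_smul r f

lemma conj_sigmaI_mul_gen_one : conj (sigmaI * gen 1) = -(sigmaI * gen 1) := by
  ext <;> simp [gen, sigmaI, conj, sigma, imag]

lemma hat_sigmaI_mul_gen_one : hat (sigmaI * gen 1) = -(sigmaI * gen 1) := by
  ext <;> simp [gen, sigmaI, hat, hatScalar, sigma, imag]

lemma conj_iI : conj iI = -iI := by ext <;> simp [conj, iI]

lemma hat_iI : hat iI = iI := by ext <;> simp [hat, hatScalar, iI, imag]

/-- The derivative of the components of a spinor, in terms of its covariant derivative `n` and of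
the values `r`, `t` of the connection forms of the normal and of the tangent bundle. -/
def spinDeriv (r t : ℝ) (f n : LorentzQuaternion) : LorentzQuaternion :=
  n + (1 / 2 * r) • (sigmaI * gen 1 * f) + (1 / 2 * t) • (iI * f)

/-- The connection terms multiply f by σiI and iI, which are odd under conjugation, so they drop out
of the derivative of f conj(f). -/
lemma mul_conj_anti {r t : ℝ} {f n : LorentzQuaternion}
    (h : spinDeriv r t f n * conj f + f * conj (spinDeriv r t f n) = 0) :
    (n * conj f).re = 0 := by
  have h1 : n * conj f + conj (n * conj f) = 0 := by
    rw [← h, spinDeriv, conj_add, conj_add, conj_smul, conj_smul, conj_mul_rev _ f,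
      conj_mul_rev _ f, conj_mul_rev n, conj_conj, conj_sigmaI_mul_gen_one, conj_iI]
    have h2 : f * conj f = conj (f * conj f) := by rw [conj_mul_rev, conj_conj]
    -- The element f conj(f) is a scalar, hence central.
    have h3 : ∀ A : LorentzQuaternion, f * (conj f * A) = A * f * conj f := by
      intro A
      rw [← mul_assoc, mul_assoc A, mul_conj]
      ext1 <;> simp [mul_comm]
    simp only [mul_add, add_mul, smul_mul_assoc, mul_smul_comm, mul_neg, smul_neg, h3]
    abel
  have h4 : (n * conj f).re + (n * conj f).re = 0 := congrArg QuaternionAlgebra.re h1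
  have h5 := congrArg QuadraticAlgebra.re h4
  have h6 := congrArg QuadraticAlgebra.im h4
  simp only [QuadraticAlgebra.re_add, QuadraticAlgebra.im_add, QuadraticAlgebra.re_zero,
    QuadraticAlgebra.im_zero] at h5 h6
  ext
  · simpa using h5
  · simpa using h6

lemma lift_deriv {r t : ℝ} {f n : LorentzQuaternion} (hf : Hform f f = 1) (C : LorentzQuaternion) :
    -(spinDeriv r t f n * C * conj (hat f) + f * C * conj (hat (spinDeriv r t f n))) =
      n * conj f * lift C f + lift C f * conj (hat (n * conj f)) +
        (1 / 2 * r) • (sigmaI * gen 1 * lift C f + lift C f * (sigmaI * gen 1)) +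
        (1 / 2 * t) • (iI * lift C f - lift C f * iI) := by
  have hn : n = n * conj f * f := by rw [mul_assoc, conj_mul_of_unit hf, mul_one]
  set e := n * conj f
  rw [hn]
  simp only [spinDeriv, hat_add, conj_add, hat_smul, conj_smul, hat_mul (_ * _), hat_mul _ f,
    conj_mul_rev _ (hat f), hat_sigmaI_mul_gen_one, hat_iI, conj_neg, conj_sigmaI_mul_gen_one,
    conj_iI, lift]
  simp only [mul_add, add_mul, smul_mul_assoc, mul_smul_comm, mul_neg, neg_mul, smul_neg,
    smul_add, smul_sub, neg_neg, mul_assoc]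
  abel

/-- A normal vector lies in the span of 1 and I, so it commutes with iI and the tangent connection
drops out. When e has only J- and K-parts, its products with the vector have only J- and K-parts
too, so these must vanish separately from the normal components. -/
lemma parallel_coeffs {r t a b a' b' : ℝ} {e : LorentzQuaternion} (h0 : e.re = 0) (h1 : e.imI = 0)
    (h : vec ![a', b', 0, 0] = e * vec ![a, b, 0, 0] + vec ![a, b, 0, 0] * conj (hat e) +
        (1 / 2 * r) • (sigmaI * gen 1 * vec ![a, b, 0, 0] +
          vec ![a, b, 0, 0] * (sigmaI * gen 1)) +
        (1 / 2 * t) • (iI * vec ![a, b, 0, 0] - vec ![a, b, 0, 0] * iI)) :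
    a' = -(r * b) ∧ b' = -(r * a) ∧
      a * Complex.I * e.imJ.im + b * e.imK.re = 0 ∧
      a * Complex.I * e.imK.im - b * e.imJ.re = 0 := by
  obtain ⟨e0, e1, ⟨e2, e2'⟩, ⟨e3, e3'⟩⟩ := e
  obtain rfl : e0 = 0 := h0
  obtain rfl : e1 = 0 := h1
  simp [vec_eq, QuaternionAlgebra.ext_iff, QuadraticAlgebra.ext_iff, sigmaI, gen, iI, sigma, imag,
    hat, hatScalar, conj] at h
  obtain ⟨⟨-, h5⟩, ⟨h6, -⟩, ⟨h7, -⟩, h8, -⟩ := h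
  have hI : Complex.I * Complex.I = -1 := Complex.I_mul_I
  refine ⟨?_, ?_, by linear_combination -h7 / 2, by linear_combination -h8 / 2⟩
  -- The e₀-coordinate carries a factor i, which multiplication by -i removes.
  · have : (a' : ℂ) = ((-(r * b) : ℝ) : ℂ) := by
      push_cast
      linear_combination -Complex.I * h5 + (a' + r * b) * hI
    exact_mod_cast this
  · have : (b' : ℂ) = ((-(r * a) : ℝ) : ℂ) := by
      push_cast
      linear_combination h6 + r * a * hI
    exact_mod_cast this

lemma dirac_coeffs {f n₂ n₃ : LorentzQuaternion} {a b : ℝ} (hf : Hform f f = 1)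
    (h : -(cliff (gen 2) n₂) + cliff (gen 3) n₃ = cliff (vec ![a, b, 0, 0]) f) :
    -(gen 2 * hat (n₂ * conj f)) + gen 3 * hat (n₃ * conj f) = vec ![a, b, 0, 0] := by
  -- This map recovers y from the Clifford product of y with f.
  have h1 := congrArg (fun z ↦ -(sigmaI * z * conj (hat f))) h
  simp only [cliff, mul_add, add_mul, ← mul_assoc, sigmaI_sq, mul_neg, neg_mul, neg_neg] at h1
  rw [mul_assoc _ (hat f), hat_mul_conj_hat hf] at h1
  rw [hat_mul, hat_mul, hat_conj, ← mul_assoc, ← mul_assoc]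
  simpa [add_comm] using h1

/-- The absence of J- and K-parts on the right kills the I-parts; the two normal components express
the mean curvature vector. -/
lemma dirac_components {e₂ e₃ : LorentzQuaternion} {a b : ℝ} (h2 : e₂.re = 0) (h3 : e₃.re = 0)
    (h : -(gen 2 * hat e₂) + gen 3 * hat e₃ = vec ![a, b, 0, 0]) :
    e₂.imI = 0 ∧ e₃.imI = 0 ∧ a * Complex.I = e₃.imK.im - Complex.I * e₂.imJ.im ∧
      (b : ℂ) = -e₃.imJ.re - Complex.I * e₂.imK.re := by
  obtain ⟨e0, ⟨e1, e1'⟩, ⟨e2, e2'⟩, ⟨e3, e3'⟩⟩ := e₂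
  obtain ⟨d0, ⟨d1, d1'⟩, ⟨d2, d2'⟩, ⟨d3, d3'⟩⟩ := e₃
  obtain rfl : e0 = 0 := h2
  obtain rfl : d0 = 0 := h3
  simp [vec_eq, QuaternionAlgebra.ext_iff, QuadraticAlgebra.ext_iff, gen, imag,
    hat, hatScalar] at h ⊢
  obtain ⟨⟨-, h5⟩, ⟨h6, -⟩, hd, he⟩ := h
  exact ⟨he, hd, by linear_combination -h5, by linear_combination -h6⟩

lemma lift_coeffs {r t a b a' b' : ℝ} {f n C : LorentzQuaternion} (hf : Hform f f = 1)
    (hC : lift C f = vec ![a, b, 0, 0])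
    (h : spinDeriv r t f n * conj f + f * conj (spinDeriv r t f n) = 0)
    (h' : vec ![a', b', 0, 0] =
      -(spinDeriv r t f n * C * conj (hat f) + f * C * conj (hat (spinDeriv r t f n))))
    (hI : (n * conj f).imI = 0) :
    a' = -(r * b) ∧ b' = -(r * a) ∧
      a * Complex.I * (n * conj f).imJ.im + b * (n * conj f).imK.re = 0 ∧
      a * Complex.I * (n * conj f).imK.im - b * (n * conj f).imJ.re = 0 := by
  rw [lift_deriv hf, hC] at h'
  exact parallel_coeffs (mul_conj_anti h) hI h'

lemma form_eq_zero_of_coeffs {a b h₀ h₁ : ℝ} {e₂ e₃ : LorentzQuaternion}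
    (h0 : h₀ * Complex.I = e₃.imK.im - Complex.I * e₂.imJ.im)
    (h1 : (h₁ : ℂ) = -e₃.imJ.re - Complex.I * e₂.imK.re)
    (h2 : a * Complex.I * e₂.imJ.im + b * e₂.imK.re = 0)
    (h3 : a * Complex.I * e₃.imK.im - b * e₃.imJ.re = 0) :
    -(a * h₀) + b * h₁ = 0 := by
  have hI : Complex.I * Complex.I = -1 := Complex.I_mul_I
  have : ((-(a * h₀) + b * h₁ : ℝ) : ℂ) = 0 := by
    push_cast
    linear_combination a * Complex.I * h0 + b * h1 - a * h₀ * hI + h3 - Complex.I * h2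
  exact_mod_cast this

/-! ### Differential calculus of quaternion-valued maps -/

/-- The coordinates of a quaternion, as a real linear equivalence. -/
def coordₗ : LorentzQuaternion ≃ₗ[ℝ] (Fin 4 → Fin 2 → ℂ) where
  toFun := toCoord
  invFun := ofCoord
  map_add' f g := by ext i j; fin_cases i <;> fin_cases j <;> simp [toCoord]
  map_smul' r f := by ext i j; fin_cases i <;> fin_cases j <;> simp [toCoord]
  left_inv f := rfl
  right_inv c := by ext i j; fin_cases i <;> fin_cases j <;> rfl

/-- A bilinear map on quaternions, as a continuous bilinear map in coordinates. -/
def coordBilin {Z : Type*} [NormedAddCommGroup Z] [NormedSpace ℝ Z]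
    (B : LorentzQuaternion →ₗ[ℝ] LorentzQuaternion →ₗ[ℝ] Z) :
    (Fin 4 → Fin 2 → ℂ) →L[ℝ] (Fin 4 → Fin 2 → ℂ) →L[ℝ] Z :=
  LinearMap.toContinuousLinearMap
    (LinearMap.toContinuousLinearMap.toLinearMap ∘ₗ
      (B.compl₁₂ coordₗ.symm.toLinearMap coordₗ.symm.toLinearMap))

section Calculus

variable {M : Type*} [TopologicalSpace M] [ChartedSpace Plane M]

lemma contMDiffOn_bilin {Z : Type*} [NormedAddCommGroup Z] [NormedSpace ℝ Z]
    (B : LorentzQuaternion →ₗ[ℝ] LorentzQuaternion →ₗ[ℝ] Z) {f : M → LorentzQuaternion} {U : Set M}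
    (hf : ContMDiffOn 𝓘(ℝ, Plane) 𝓘(ℝ, Fin 4 → Fin 2 → ℂ) ∞ (fun y ↦ toCoord (f y)) U) :
    ContMDiffOn 𝓘(ℝ, Plane) 𝓘(ℝ, Z) ∞ (fun y ↦ B (f y) (f y)) U := by
  have h : ContDiff ℝ ∞ (fun c ↦ coordBilin B c c) := by fun_prop
  exact h.contMDiff.comp_contMDiffOn hf

lemma mvfderiv_comp_hasFDerivAt {V Z : Type*} [NormedAddCommGroup V] [NormedSpace ℝ V]
    [NormedAddCommGroup Z] [NormedSpace ℝ Z] {G : V → Z} {G' : V →L[ℝ] Z} {f : M → V} {x : M}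
    (hG : HasFDerivAt G G' (f x)) (hf : MDifferentiableAt 𝓘(ℝ, Plane) 𝓘(ℝ, V) f x)
    (X : TangentSpace 𝓘(ℝ, Plane) x) :
    mvfderiv 𝓘(ℝ, Plane) (fun y ↦ G (f y)) x X = G' (mvfderiv 𝓘(ℝ, Plane) f x X) :=
  DFunLike.congr_fun (hG.hasMFDerivAt.comp x hf.hasMFDerivAt).mfderiv X

lemma mvfderiv_congr {Z : Type*} [NormedAddCommGroup Z] [NormedSpace ℝ Z] {f g : M → Z} {x : M}
    (h : f =ᶠ[𝓝 x] g) : mvfderiv 𝓘(ℝ, Plane) f x = mvfderiv 𝓘(ℝ, Plane) g x := by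
  have hx := h.self_of_nhds
  ext X
  exact DFunLike.congr_fun h.mfderiv_eq X

lemma mvfderiv_bilin {Z : Type*} [NormedAddCommGroup Z] [NormedSpace ℝ Z]
    (B : LorentzQuaternion →ₗ[ℝ] LorentzQuaternion →ₗ[ℝ] Z) {f : M → LorentzQuaternion} {x : M}
    (hf : MDifferentiableAt 𝓘(ℝ, Plane) 𝓘(ℝ, Fin 4 → Fin 2 → ℂ) (fun y ↦ toCoord (f y)) x)
    (X : TangentSpace 𝓘(ℝ, Plane) x) :
    mvfderiv 𝓘(ℝ, Plane) (fun y ↦ B (f y) (f y)) x X =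
      B (ofCoord (mvfderiv 𝓘(ℝ, Plane) (fun y ↦ toCoord (f y)) x X)) (f x) +
      B (f x) (ofCoord (mvfderiv 𝓘(ℝ, Plane) (fun y ↦ toCoord (f y)) x X)) := by
  have h := (coordBilin B).hasFDerivAt_of_bilinear (hasFDerivAt_id (toCoord (f x)))
    (hasFDerivAt_id (toCoord (f x)))
  have h2 := mvfderiv_comp_hasFDerivAt (f := fun y ↦ toCoord (f y)) h hf X
  rw [add_comm]
  exact h2

/-- The bilinear map `(f, g) ↦ f conj(g)`. -/
def normBilin : LorentzQuaternion →ₗ[ℝ] LorentzQuaternion →ₗ[ℝ] LorentzQuaternion :=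
  (LinearMap.mul ℝ LorentzQuaternion).compl₂ conjₗ

/-- The bilinear map `(f, g) ↦ -f C conj(ĝ)`. -/
def liftBilin (C : LorentzQuaternion) :
    LorentzQuaternion →ₗ[ℝ] LorentzQuaternion →ₗ[ℝ] LorentzQuaternion :=
  -((LinearMap.mul ℝ LorentzQuaternion).compl₁₂ (LinearMap.mulRight ℝ C) (conjₗ ∘ₗ hatₗ))

/-- The derivative of a quaternion-valued map along a tangent vector. -/
def qderiv (f : M → LorentzQuaternion) (x : M) (X : TangentSpace 𝓘(ℝ, Plane) x) :
    LorentzQuaternion :=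
  ofCoord (mvfderiv 𝓘(ℝ, Plane) (fun y ↦ toCoord (f y)) x X)

lemma qderiv_bilin (B : LorentzQuaternion →ₗ[ℝ] LorentzQuaternion →ₗ[ℝ] LorentzQuaternion)
    {f : M → LorentzQuaternion} {x : M}
    (hf : MDifferentiableAt 𝓘(ℝ, Plane) 𝓘(ℝ, Fin 4 → Fin 2 → ℂ) (fun y ↦ toCoord (f y)) x)
    (X : TangentSpace 𝓘(ℝ, Plane) x) :
    qderiv (fun y ↦ B (f y) (f y)) x X = B (qderiv f x X) (f x) + B (f x) (qderiv f x X) := by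
  have h := mvfderiv_bilin (B.compr₂ coordₗ.toLinearMap) hf X
  refine (congrArg ofCoord h).trans ?_
  exact (map_add coordₗ.symm _ _).trans
    (congrArg₂ _ (coordₗ.symm_apply_apply _) (coordₗ.symm_apply_apply _))

lemma qderiv_congr {f g : M → LorentzQuaternion} {x : M} (h : f =ᶠ[𝓝 x] g)
    (X : TangentSpace 𝓘(ℝ, Plane) x) : qderiv f x X = qderiv g x X := by
  exact congrArg (fun L ↦ ofCoord (L X)) (mvfderiv_congr (h.fun_comp toCoord))

lemma qderiv_const (c : LorentzQuaternion) (x : M) (X : TangentSpace 𝓘(ℝ, Plane) x) :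
    qderiv (fun _ ↦ c) x X = 0 := by
  rw [qderiv, mvfderiv_const]
  exact map_zero coordₗ.symm

lemma vec_pair (a b : ℝ) : vec ![a, b, 0, 0] = a • gen 0 + b • gen 1 := by
  simp [vec, Fin.sum_univ_four]

lemma qderiv_vec_pair {a b : M → ℝ} {x : M} (ha : MDifferentiableAt 𝓘(ℝ, Plane) 𝓘(ℝ, ℝ) a x)
    (hb : MDifferentiableAt 𝓘(ℝ, Plane) 𝓘(ℝ, ℝ) b x) (X : TangentSpace 𝓘(ℝ, Plane) x) :
    qderiv (fun y ↦ vec ![a y, b y, 0, 0]) x X =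
      vec ![mvfderiv 𝓘(ℝ, Plane) a x X, mvfderiv 𝓘(ℝ, Plane) b x X, 0, 0] := by
  have h : (fun y ↦ toCoord (vec ![a y, b y, 0, 0])) =
      (fun y ↦ (ContinuousLinearMap.toSpanSingleton ℝ (toCoord (gen 0))) (a y)) +
      (fun y ↦ (ContinuousLinearMap.toSpanSingleton ℝ (toCoord (gen 1))) (b y)) := by
    funext y
    rw [vec_pair]
    exact (map_add coordₗ _ _).trans (congrArg₂ _ (map_smul coordₗ _ _) (map_smul coordₗ _ _))
  have h0 := (ContinuousLinearMap.toSpanSingleton ℝ (toCoord (gen 0))).hasFDerivAt (x := a x)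
  have h1 := (ContinuousLinearMap.toSpanSingleton ℝ (toCoord (gen 1))).hasFDerivAt (x := b x)
  have h2 := mvfderiv_add (h0.differentiableAt.mdifferentiableAt.comp x ha)
    (h1.differentiableAt.mdifferentiableAt.comp x hb)
  simp only [Function.comp_def] at h2
  rw [qderiv, h, h2, add_apply,
    mvfderiv_comp_hasFDerivAt h0 ha, mvfderiv_comp_hasFDerivAt h1 hb, vec_pair]
  refine (map_add coordₗ.symm _ _).trans (congrArg₂ _ ?_ ?_) <;>
  exact (map_smul coordₗ.symm _ _).trans (congrArg _ (coordₗ.symm_apply_apply _))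

/-- The coordinate along `e₀`. -/
def coordZero : LorentzQuaternion →ₗ[ℝ] ℝ where
  toFun q := q.re.im.im
  map_add' f g := by simp
  map_smul' r f := by simp

/-- The coordinate along `e₁`. -/
def coordOne : LorentzQuaternion →ₗ[ℝ] ℝ where
  toFun q := q.imI.re.re
  map_add' f g := by simp
  map_smul' r f := by simp

lemma coordZero_vec (x : Fin 4 → ℝ) : coordZero (vec x) = x 0 := by simp [coordZero, vec_eq]

lemma coordOne_vec (x : Fin 4 → ℝ) : coordOne (vec x) = x 1 := by simp [coordOne, vec_eq]

/-- A function on a connected surface with vanishing derivative is constant. -/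
lemma eq_of_mvfderiv_eq_zero [IsManifold 𝓘(ℝ, Plane) ∞ M] [PreconnectedSpace M] {f : M → ℝ}
    (hf : ContMDiff 𝓘(ℝ, Plane) 𝓘(ℝ, ℝ) ∞ f)
    (h : ∀ x X, mvfderiv 𝓘(ℝ, Plane) f x X = 0) (x y : M) : f x = f y := by
  refine IsLocallyConstant.apply_eq_of_isPreconnected ?_ isPreconnected_univ trivial trivial
  rw [IsLocallyConstant.iff_eventually_eq]
  intro x
  set e := chartAt Plane x
  obtain ⟨r, hr, hball⟩ := Metric.isOpen_iff.1 e.open_target (e x)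
    (e.map_source (mem_chart_source Plane x))
  have hs : ContMDiffOn 𝓘(ℝ, Plane) 𝓘(ℝ, Plane) ∞ e.symm e.target :=
    contMDiffOn_chart_symm
  -- In a chart the derivative vanishes on a ball, which is convex, so the function is locally
  -- constant.
  have hd : ∀ z ∈ Metric.ball (e x) r, HasFDerivAt (f ∘ e.symm) (0 : Plane →L[ℝ] ℝ) z := by
    intro z hz
    have h1 : MDifferentiableAt 𝓘(ℝ, Plane) 𝓘(ℝ, Plane) e.symm z :=
      (hs.contMDiffAt (e.open_target.mem_nhds (hball hz))).mdifferentiableAt (by simp)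
    have h2 : MDifferentiableAt 𝓘(ℝ, Plane) 𝓘(ℝ, ℝ) f (e.symm z) :=
      hf.mdifferentiableAt (by simp)
    have h3 := (h2.hasMFDerivAt.comp z h1.hasMFDerivAt).hasFDerivAt
    exact h3.congr_fderiv (ContinuousLinearMap.ext fun v ↦
      h (e.symm z) (mfderiv 𝓘(ℝ, Plane) 𝓘(ℝ, Plane) e.symm z v))
  have hc : ∀ z ∈ Metric.ball (e x) r, (f ∘ e.symm) z = (f ∘ e.symm) (e x) := by
    intro z hz
    exact (convex_ball (e x) r).is_const_of_fderivWithin_eq_zero (𝕜 := ℝ)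
      (fun w hw ↦ (hd w hw).differentiableAt.differentiableWithinAt)
      (fun w hw ↦ ((hd w hw).hasFDerivWithinAt).fderivWithin
        (Metric.isOpen_ball.uniqueDiffWithinAt hw)) hz (Metric.mem_ball_self hr)
  have hn : e ⁻¹' Metric.ball (e x) r ∈ 𝓝 x :=
    (e.continuousAt (mem_chart_source Plane x)).preimage_mem_nhds (Metric.ball_mem_nhds _ hr)
  filter_upwards [hn, e.open_source.mem_nhds (mem_chart_source Plane x)] with y hy hy'
  have := hc (e y) hy
  simpa [e.left_inv hy', e.left_inv (mem_chart_source Plane x)] using this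

end Calculus

/-! ### Orthonormal frames, local spin frames and smooth sections -/

section Frames

variable {M : Type*} [TopologicalSpace M] [ChartedSpace Plane M]
  {V : M → Type*} [TopologicalSpace (TotalSpace Plane V)]
  [∀ x, TopologicalSpace (V x)] [∀ x, AddCommGroup (V x)] [∀ x, Module ℝ (V x)]
  [∀ x, IsTopologicalAddGroup (V x)] [∀ x, ContinuousSMul ℝ (V x)]
  [FiberBundle Plane V] [VectorBundle ℝ Plane V]
  {g : LorentzMetric V} {o : SpaceTimeOrientation g}
  {P : Type*} [TopologicalSpace P] [MulAction Spin11 P]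

lemma LorentzMetric.IsOrthonormal.expand (o : SpaceTimeOrientation g) {x : M} {u v : V x}
    (h : g.IsOrthonormal x u v) (w : V x) :
    w = -(g.inner x w u) • u + g.inner x w v • v := by
  -- A positive frame at `x` supplies a basis, hence the dimension two of the fibre.
  obtain ⟨U, -, hxU, t, s, -, -, hts⟩ := o.locally_frame x
  obtain ⟨-, -, b, -⟩ := hts x hxU
  have hfin : Module.finrank ℝ (V x) = 2 := by
    rw [Module.finrank_eq_card_basis b, Fintype.card_fin]
  have : FiniteDimensional ℝ (V x) := b.finiteDimensional_of_finite
  obtain ⟨huu, hvv, huv⟩ := h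
  have hvu : g.inner x v u = 0 := by rw [g.symm, huv]
  have hli : LinearIndependent ℝ ![u, v] := by
    rw [LinearIndependent.pair_iff]
    intro c d hcd
    have h1 := congrArg (fun z ↦ g.inner x z u) hcd
    have h2 := congrArg (fun z ↦ g.inner x z v) hcd
    simp [huu, hvv, huv, hvu] at h1 h2
    exact ⟨h1, h2⟩
  have hspan := hli.span_eq_top_of_card_eq_finrank (by simp [hfin])
  have hw : w ∈ Submodule.span ℝ {u, v} := by
    have : Set.range ![u, v] = {u, v} := Matrix.range_cons_cons_empty u v _
    rw [← this, hspan]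
    trivial
  obtain ⟨c, d, rfl⟩ := Submodule.mem_span_pair.1 hw
  simp [huu, hvv, huv, hvu]

lemma LorentzMetric.IsOrthonormal.clm_ext (o : SpaceTimeOrientation g) {x : M} {u v : V x}
    (h : g.IsOrthonormal x u v) {L L' : V x →L[ℝ] ℝ} (hu : L u = L' u) (hv : L v = L' v)
    (w : V x) : L w = L' w := by
  rw [h.expand o w, map_add, map_add, map_smul, map_smul, map_smul, map_smul, hu, hv]

namespace SpinStructure

lemma coord_eq (S : SpinStructure o P) {p : P} {x : M} {t s : V x}
    (h : (S.proj p).1 = ⟨x, (t, s)⟩) (ν : ∀ x, V x) :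
    S.coord p (ν (S.base p)) = (-(g.inner x (ν x) t), g.inner x (ν x) s) :=
  congrArg (fun z : TotalSpace (Plane × Plane) (V ×ᵇ V) ↦
    (-(g.inner z.1 (ν z.1) z.2.1), g.inner z.1 (ν z.1) z.2.2)) h

lemma isOrthonormal (S : SpinStructure o P) {p : P} {x : M} {t s : V x}
    (h : (S.proj p).1 = ⟨x, (t, s)⟩) : g.IsOrthonormal x t s := by
  have h1 := (S.proj p).2.1
  rw [h] at h1
  exact h1

lemma exists_base (S : SpinStructure o P) (x : M) : ∃ p, S.base p = x := by
  obtain ⟨U, -, hxU, t, s, -, -, hts⟩ := o.locally_frame x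
  obtain ⟨p, hp⟩ := S.surjective ⟨⟨x, (t x, s x)⟩, hts x hxU⟩
  exact ⟨p, by rw [base, hp]⟩

/-- The restriction of a local spin frame to a smaller open set. -/
def LocalFrame.restrict {S : SpinStructure o P} {U W : Set M} (s : S.LocalFrame U)
    (hW : IsOpen W) (hWU : W ⊆ U) : S.LocalFrame W where
  isOpen := hW
  lift := s.lift
  timelike := s.timelike
  spacelike := s.spacelike
  continuousOn_lift := s.continuousOn_lift.mono hWU
  smooth_timelike := s.smooth_timelike.mono hWU
  smooth_spacelike := s.smooth_spacelike.mono hWU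
  proj_lift x hx := s.proj_lift x (hWU hx)

lemma LocalFrame.base_lift {S : SpinStructure o P} {U : Set M} (s : S.LocalFrame U) {x : M}
    (hx : x ∈ U) : S.base (s.lift x) = x := by
  rw [base, s.proj_lift x hx]

/-- A covering map is a local homeomorphism, so a local inverse lifts a smooth positive frame to the
spin structure near `x`. -/
lemma exists_localFrame (S : SpinStructure o P) (x : M) :
    ∃ U : Set M, x ∈ U ∧ Nonempty (S.LocalFrame U) := by
  classical
  obtain ⟨U, hU, hxU, t, s, ht, hs, hts⟩ := o.locally_frame x
  let σ : U → FrameBundle o := fun y ↦ ⟨⟨y, (t y, s y)⟩, hts y y.2⟩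
  have hσ : Continuous σ := by
    refine Continuous.subtype_mk ?_ _
    rw [(FiberBundle.Prod.isInducing_diag Plane V Plane V).continuous_iff]
    exact (continuousOn_iff_continuous_domRestrict.1 ht.continuousOn).prodMk
      (continuousOn_iff_continuous_domRestrict.1 hs.continuousOn)
  obtain ⟨p, hp⟩ := S.surjective (σ ⟨x, hxU⟩)
  obtain ⟨e, hpe, he⟩ := S.isCoveringMap.isLocalHomeomorph p
  have hopen : IsOpen (σ ⁻¹' e.target) := e.open_target.preimage hσ
  let W : Set M := Subtype.val '' (σ ⁻¹' e.target)
  have hW : IsOpen W := hU.isOpenMap_subtype_val _ hopen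
  have hWU : W ⊆ U := by
    rintro _ ⟨y, -, rfl⟩
    exact y.2
  have hWe : ∀ y (hy : y ∈ U), y ∈ W → σ ⟨y, hy⟩ ∈ e.target := by
    rintro _ hy ⟨z, hz, rfl⟩
    exact hz
  refine ⟨W, ⟨⟨x, hxU⟩, ?_, rfl⟩, ⟨⟨hW, fun y ↦ if hy : y ∈ U then e.symm (σ ⟨y, hy⟩) else p, t, s,
    ?_, ht.mono hWU, hs.mono hWU, ?_⟩⟩⟩
  · change σ ⟨x, hxU⟩ ∈ e.target
    rw [← hp, he]
    exact e.map_source hpe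
  · rw [continuousOn_iff_continuous_domRestrict]
    have h1 : Continuous (fun y : W ↦ σ ⟨y, hWU y.2⟩) :=
      hσ.comp (continuous_subtype_val.subtype_mk _)
    have h2 := e.continuousOn_symm.comp_continuous h1 (fun y ↦ hWe y (hWU y.2) y.2)
    refine h2.congr fun y ↦ ?_
    simp [Set.domRestrict, hWU y.2]
  · intro y hy
    have h1 : S.proj (e.symm (σ ⟨y, hWU hy⟩)) = σ ⟨y, hWU hy⟩ := by
      rw [he]
      exact e.right_inv (hWe y (hWU hy) hy)
    simp only [hWU hy, dif_pos, h1]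
    rfl

end SpinStructure

lemma smoothSection_of_locally {ν : ∀ x, V x}
    (h : ∀ x, ∃ U : Set M, IsOpen U ∧ x ∈ U ∧ SmoothSectionOn ν U) :
    SmoothSectionOn ν Set.univ := by
  intro x _
  obtain ⟨U, hU, hx, hν⟩ := h x
  exact (hν.contMDiffAt (hU.mem_nhds hx)).contMDiffWithinAt

lemma SmoothSectionOn.congr {ν μ : ∀ x, V x} {U : Set M} (h : SmoothSectionOn μ U)
    (hνμ : ∀ x ∈ U, ν x = μ x) : SmoothSectionOn ν U :=
  ContMDiffOn.congr h fun x hx ↦ by rw [hνμ x hx]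

lemma SmoothSectionOn.combination {s t : ∀ x, V x} {a b : M → ℝ} {U : Set M}
    (ha : ContMDiffOn 𝓘(ℝ, Plane) 𝓘(ℝ, ℝ) ∞ a U) (hb : ContMDiffOn 𝓘(ℝ, Plane) 𝓘(ℝ, ℝ) ∞ b U)
    (hs : SmoothSectionOn s U) (ht : SmoothSectionOn t U) :
    SmoothSectionOn (a • s + b • t) U :=
  (ha.smul_section hs).add_section (hb.smul_section ht)

lemma SmoothSectionOn.mdifferentiableAt {s : ∀ x, V x} {U : Set M} (hs : SmoothSectionOn s U)
    (hU : IsOpen U) {x : M} (hx : x ∈ U) :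
    MDifferentiableAt 𝓘(ℝ, Plane) (𝓘(ℝ, Plane).prod 𝓘(ℝ, Plane))
      (fun y ↦ TotalSpace.mk' Plane y (s y)) x :=
  (hs.contMDiffAt (hU.mem_nhds hx)).mdifferentiableAt (by simp)

end Frames

/-! ### Change of spin frame -/

lemma lift_mul (C m f : LorentzQuaternion) : lift C (m * f) = m * lift C f * conj (hat m) := by
  rw [lift, lift, hat_mul, conj_mul_rev]
  simp [mul_assoc]

lemma Spin11.sign_mul_self (a : Spin11) : a.sign * a.sign = 1 := by
  rcases Int.units_eq_one_or a.1 with h | h <;> simp [Spin11.sign, h]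

/-- The element m = ±(cosh u + i sinh u I) commutes with 1 and I and is fixed by the hat map, so
conj(m̂) is its inverse and normal vectors are fixed. -/
lemma spinTangent_lift (t : Spin11) (a b : ℝ) :
    spinTangent t * vec ![a, b, 0, 0] * conj (hat (spinTangent t)) = vec ![a, b, 0, 0] := by
  have h1 : (t.sign : ℂ) * t.sign = 1 := by exact_mod_cast t.sign_mul_self
  have h2 : (Complex.cosh t.param) ^ 2 - (Complex.sinh t.param) ^ 2 = 1 :=
    Complex.cosh_sq_sub_sinh_sq _
  have hI : Complex.I * Complex.I = -1 := Complex.I_mul_I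
  have h3 : spinTangent t = ⟨⟨t.sign * Complex.cosh t.param, 0⟩,
      ⟨t.sign * Complex.sinh t.param * Complex.I, 0⟩, 0, 0⟩ := by
    ext <;> simp [spinTangent, iI, imag, QuadraticAlgebra.re_one,
      QuadraticAlgebra.im_one, mul_assoc]
  rw [h3, vec_eq]
  set s : ℂ := ((t.sign : ℝ) : ℂ)
  set c := Complex.cosh t.param
  set d := Complex.sinh t.param
  ext <;> simp [hat, hatScalar, conj]
  · ring
  · linear_combination a * Complex.I * (c ^ 2 - d ^ 2) * h1 + a * Complex.I * h2
      + a * Complex.I * s * s * d ^ 2 * hI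
  · linear_combination b * (c ^ 2 - d ^ 2) * h1 + b * h2 + b * s * s * d ^ 2 * hI
  · ring

/-- Here hat and conjugation both change the sign of σiI, so conj(m̂) = m and the action is
multiplication by m²: this doubles the parameter. -/
lemma spinNormal_lift (t : Spin11) (a b : ℝ) :
    spinNormal t * vec ![a, b, 0, 0] * conj (hat (spinNormal t)) =
      vec ![Real.cosh (2 * t.param) * a - Real.sinh (2 * t.param) * b,
        -(Real.sinh (2 * t.param) * a) + Real.cosh (2 * t.param) * b, 0, 0] := by
  have h1 : (t.sign : ℂ) * t.sign = 1 := by exact_mod_cast t.sign_mul_self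
  have hI : Complex.I * Complex.I = -1 := Complex.I_mul_I
  have h3 : spinNormal t = ⟨⟨t.sign * Complex.cosh t.param, 0⟩,
      ⟨0, t.sign * Complex.sinh t.param * Complex.I⟩, 0, 0⟩ := by
    ext <;> simp [spinNormal, sigmaI, gen, sigma, imag, QuadraticAlgebra.re_one,
      QuadraticAlgebra.im_one, mul_assoc]
  rw [h3, vec_eq, vec_eq]
  simp only [Real.cosh_two_mul, Real.sinh_two_mul]
  set s : ℂ := ((t.sign : ℝ) : ℂ)
  ext <;> simp [hat, hatScalar, conj]
  all_goals set c := Complex.cosh t.param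
  all_goals set d := Complex.sinh t.param
  · linear_combination (-(2 * c * d * b * Complex.I) + c ^ 2 * a * Complex.I
      + a * d ^ 2 * Complex.I) * h1 - s * s * a * Complex.I * d ^ 2 * hI
  · linear_combination (-(2 * d * c * a) + (c ^ 2 + d ^ 2) * b) * h1
      + s * s * (2 * c * a * d - d ^ 2 * b) * hI

lemma Spin11.param_inv (t : Spin11) : Spin11.param t⁻¹ = -t.param := rfl

lemma lift_spin (C f : LorentzQuaternion) {a b : ℝ} (h : lift C f = vec ![a, b, 0, 0])
    (s t : Spin11) :
    lift C (spinNormal s⁻¹ * spinTangent t⁻¹ * f) =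
      vec ![Real.cosh (2 * s.param) * a + Real.sinh (2 * s.param) * b,
        Real.sinh (2 * s.param) * a + Real.cosh (2 * s.param) * b, 0, 0] := by
  rw [mul_assoc, lift_mul, lift_mul, h, spinTangent_lift, spinNormal_lift, Spin11.param_inv]
  simp

/-! ### Compatible connections in an orthonormal frame -/

section

variable {M : Type*} [TopologicalSpace M] [ChartedSpace Plane M]
  {V : M → Type*} [TopologicalSpace (TotalSpace Plane V)]
  [∀ x, TopologicalSpace (V x)] [∀ x, AddCommGroup (V x)] [∀ x, Module ℝ (V x)]
  [∀ x, IsTopologicalAddGroup (V x)] [∀ x, ContinuousSMul ℝ (V x)]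
  [FiberBundle Plane V] [VectorBundle ℝ Plane V]
  {g : LorentzMetric V} {cov : CovariantDerivative 𝓘(ℝ, Plane) Plane V}

/-- Differentiating the constant scalar products leaves one connection form; in signature (1,1) it
enters both derivatives with the same sign. -/
lemma LorentzMetric.IsCompatible.cov_frame (hcov : g.IsCompatible cov)
    (o : SpaceTimeOrientation g) {t s : ∀ x, V x} {U : Set M} (hU : IsOpen U)
    (ht : SmoothSectionOn t U) (hs : SmoothSectionOn s U)
    (hts : ∀ x ∈ U, g.IsOrthonormal x (t x) (s x)) {x : M} (hx : x ∈ U)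
    (X : TangentSpace 𝓘(ℝ, Plane) x) :
    cov t x X = g.inner x (cov t x X) (s x) • s x ∧
      cov s x X = g.inner x (cov t x X) (s x) • t x := by
  have key : ∀ (c : ℝ) (v w : ∀ x, V x), SmoothSectionOn v U → SmoothSectionOn w U →
      (∀ y ∈ U, g.inner y (v y) (w y) = c) →
      g.inner x (cov v x X) (w x) + g.inner x (v x) (cov w x X) = 0 := by
    intro c v w hv hw hc
    rw [← hcov v w x (hv.mdifferentiableAt hU hx) (hw.mdifferentiableAt hU hx) X,
      mvfderiv_congr (g := fun _ ↦ c) (Filter.eventuallyEq_of_mem (hU.mem_nhds hx) hc),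
      mvfderiv_const]
    rfl
  have h1 := key _ t t ht ht fun y hy ↦ (hts y hy).1
  have h2 := key _ s s hs hs fun y hy ↦ (hts y hy).2.1
  have h3 := key _ t s ht hs fun y hy ↦ (hts y hy).2.2
  rw [g.symm x (t x)] at h1 h3
  rw [g.symm x (s x)] at h2
  constructor
  · conv_lhs => rw [(hts x hx).expand o (cov t x X)]
    rw [show g.inner x (cov t x X) (t x) = 0 by linarith]
    simp
  · conv_lhs => rw [(hts x hx).expand o (cov s x X)]
    rw [show g.inner x (cov s x X) (s x) = 0 by linarith,
      show g.inner x (cov s x X) (t x) = -(g.inner x (cov t x X) (s x)) by linarith]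
    simp

lemma LorentzMetric.IsCompatible.cov_eq_zero (hcov : g.IsCompatible cov)
    (o : SpaceTimeOrientation g) {ν t s : ∀ x, V x} {U : Set M} (hU : IsOpen U)
    (ht : SmoothSectionOn t U) (hs : SmoothSectionOn s U)
    (hts : ∀ x ∈ U, g.IsOrthonormal x (t x) (s x)) {a b : M → ℝ}
    (ha : ContMDiffOn 𝓘(ℝ, Plane) 𝓘(ℝ, ℝ) ∞ a U) (hb : ContMDiffOn 𝓘(ℝ, Plane) 𝓘(ℝ, ℝ) ∞ b U)
    (hν : ∀ y ∈ U, ν y = a y • t y + b y • s y) {x : M} (hx : x ∈ U)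
    (h : ∀ X : TangentSpace 𝓘(ℝ, Plane) x,
      mvfderiv 𝓘(ℝ, Plane) a x X = -(g.inner x (cov t x X) (s x) * b x) ∧
      mvfderiv 𝓘(ℝ, Plane) b x X = -(g.inner x (cov t x X) (s x) * a x)) :
    cov ν x = 0 := by
  have hUx := hU.mem_nhds hx
  have hc := SmoothSectionOn.combination ha hb ht hs
  have ha' : MDifferentiableAt 𝓘(ℝ, Plane) 𝓘(ℝ, ℝ) a x :=
    (ha.contMDiffAt hUx).mdifferentiableAt (by simp)
  have hb' : MDifferentiableAt 𝓘(ℝ, Plane) 𝓘(ℝ, ℝ) b x :=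
    (hb.contMDiffAt hUx).mdifferentiableAt (by simp)
  have hC := cov.isCovariantDerivativeOnUniv
  have htx := ht.mdifferentiableAt hU hx
  have hsx := hs.mdifferentiableAt hU hx
  have has : SmoothSectionOn (a • t) U := ha.smul_section ht
  have hbs : SmoothSectionOn (b • s) U := hb.smul_section hs
  rw [cov.isCovariantDerivativeOn.congr_of_eqOn
    (SmoothSectionOn.mdifferentiableAt (hc.congr hν) hU hx) (hc.mdifferentiableAt hU hx) hUx hν,
    hC.add (has.mdifferentiableAt hU hx) (hbs.mdifferentiableAt hU hx), hC.leibniz htx ha',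
    hC.leibniz hsx hb']
  ext X
  obtain ⟨h1, h2⟩ := h X
  obtain ⟨h3, h4⟩ := hcov.cov_frame o hU ht hs hts hx X
  simp only [add_apply, smul_apply, ContinuousLinearMap.smulRight_apply, h1, h2, h4]
  rw [h3]
  simp only [map_smul, smul_apply, (hts x hx).2.1, smul_eq_mul, mul_one]
  simp
  module

end

lemma form22_single_eq_zero_iff (x : Fin 4 → ℝ) (j : Fin 4) :
    form22 x (Pi.single j 1) = 0 ↔ x j = 0 := by
  fin_cases j <;> simp [form22]

/-! ### From spinor fields to parallel sections -/

section

variable {M : Type*} [TopologicalSpace M] [ChartedSpace Plane M] [IsManifold 𝓘(ℝ, Plane) ∞ M]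
  {E : M → Type*} [TopologicalSpace (TotalSpace Plane E)]
  [∀ x, TopologicalSpace (E x)] [∀ x, AddCommGroup (E x)] [∀ x, Module ℝ (E x)]
  [∀ x, IsTopologicalAddGroup (E x)] [∀ x, ContinuousSMul ℝ (E x)]
  [FiberBundle Plane E] [VectorBundle ℝ Plane E]
  {gE : LorentzMetric E} {oE : SpaceTimeOrientation gE}
  {gM : LorentzMetric (TM M)} {oM : SpaceTimeOrientation gM}
  {PE PM : Type*} [TopologicalSpace PE] [MulAction Spin11 PE]
  [TopologicalSpace PM] [MulAction Spin11 PM]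
  {SE : SpinStructure oE PE} {SM : SpinStructure oM PM}

/-- Functions on spin frames which transform as the coordinates of a vector define a section. -/
lemma exists_section (SE : SpinStructure oE PE) (SM : SpinStructure oM PM) (A B : PE → PM → ℝ)
    (hAB : ∀ (α β : Spin11) (p : PE) (q : PM), SE.base p = SM.base q →
      A (α • p) (β • q) = Real.cosh (2 * α.param) * A p q + Real.sinh (2 * α.param) * B p q ∧
      B (α • p) (β • q) = Real.sinh (2 * α.param) * A p q + Real.cosh (2 * α.param) * B p q) :
    ∃ ν : ∀ x, E x, ∀ p q, SE.base p = SM.base q →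
      SE.coord p (ν (SE.base p)) = (A p q, B p q) := by
  have h0 : ∀ x, ∃ (t s : E x) (p : PE) (q : PM),
      (SE.proj p).1 = ⟨x, (t, s)⟩ ∧ SM.base q = x := by
    intro x
    obtain ⟨p, rfl⟩ := SE.exists_base x
    obtain ⟨q, hq⟩ := SM.exists_base (SE.base p)
    exact ⟨SE.vecT p, SE.vecS p, p, q, rfl, hq⟩
  choose t s p₀ q₀ hp hq using h0
  refine ⟨fun x ↦ A (p₀ x) (q₀ x) • t x + B (p₀ x) (q₀ x) • s x, fun p q hpq ↦ ?_⟩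
  set x := SE.base p with hx
  have hbp : SE.base (p₀ x) = x := by rw [SpinStructure.base, hp]
  -- The section was built from chosen spin frames; any other pair over `x` is a translate of the
  -- chosen one, and the transformation law matches the change of orthonormal frame.
  obtain ⟨α, hα, -⟩ := SE.simply_transitive (p₀ x) p hbp
  obtain ⟨β, hβ, -⟩ := SM.simply_transitive (q₀ x) q ((hq x).trans hpq)
  have hproj : (SE.proj p).1 = ⟨x,
      (Real.cosh (2 * α.param) • t x - Real.sinh (2 * α.param) • s x,
        -(Real.sinh (2 * α.param) • t x) + Real.cosh (2 * α.param) • s x)⟩ := by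
    rw [← hα, SE.equivariant]
    exact congrArg (fun z : TotalSpace (Plane × Plane) (E ×ᵇ E) ↦
      (⟨z.proj, (Real.cosh (2 * α.param) • z.2.1 - Real.sinh (2 * α.param) • z.2.2,
        -(Real.sinh (2 * α.param) • z.2.1) + Real.cosh (2 * α.param) • z.2.2)⟩ :
        TotalSpace (Plane × Plane) (E ×ᵇ E))) (hp x)
  obtain ⟨h1, h2, h3⟩ := SE.isOrthonormal (hp x)
  obtain ⟨h4, h5⟩ := hAB α β (p₀ x) (q₀ x) (hbp.trans (hq x).symm)
  rw [hα, hβ] at h4 h5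
  have h6 : gE.inner x (s x) (t x) = 0 := by rw [gE.symm, h3]
  rw [SE.coord_eq hproj (fun x ↦ A (p₀ x) (q₀ x) • t x + B (p₀ x) (q₀ x) • s x), h4, h5]
  simp [h1, h2, h3, h6]
  constructor <;> ring

namespace SpinorField

variable {φ : SpinorField SE SM}

lemma form22_mvfderiv {F : M → Fin 4 → ℝ} (hF : φ.IsImmersionOf F) {p : PE} {q : PM}
    (hpq : SE.base p = SM.base q) (X : TM M (SM.base q)) (j : Fin 4) {x : Fin 4 → ℝ}
    (hx : lift (gen j) (φ.comp p q) = vec x) :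
    form22 (mvfderiv 𝓘(ℝ, Plane) F (SM.base q) X) (Pi.single j 1) =
      form22 ![0, 0, (SM.coord q X).1, (SM.coord q X).2] x := by
  have h := Hform_pairing (φ.comp p q) (repM SM q X) (gen j)
  rw [← hF.2 p q hpq X, hx, repM, gen_eq_vec, Hform_vec, Hform_vec] at h
  exact Complex.ofReal_injective (congrArg QuadraticAlgebra.re h)

lemma mvfderiv_coord {F : M → Fin 4 → ℝ} (hF : φ.IsImmersionOf F) (j : Fin 4) (x : M)
    (X : TM M x) :
    mvfderiv 𝓘(ℝ, Plane) (fun y ↦ F y j) x X = mvfderiv 𝓘(ℝ, Plane) F x X j :=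
  mvfderiv_comp_hasFDerivAt
    (ContinuousLinearMap.proj (R := ℝ) (φ := fun _ : Fin 4 ↦ ℝ) j).hasFDerivAt
    (hF.1.mdifferentiableAt (by simp)) X

/-- A normal vector is orthogonal to every tangent X, so the j-th coordinate of F has zero
derivative. -/
lemma liesIn_of_lift [PreconnectedSpace M] [Nonempty M] {F : M → Fin 4 → ℝ}
    (hF : φ.IsImmersionOf F) {j : Fin 4}
    (h : ∀ p q, SE.base p = SM.base q → ∃ a b, lift (gen j) (φ.comp p q) = vec ![a, b, 0, 0]) :
    LiesIn F {x | form22 x (Pi.single j 1) = 0} := by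
  obtain ⟨x₀⟩ := ‹Nonempty M›
  refine ⟨F x₀, fun x ↦ ?_⟩
  rw [Set.mem_ofPred_eq, form22_single_eq_zero_iff, Pi.sub_apply, sub_eq_zero]
  refine eq_of_mvfderiv_eq_zero (f := fun y ↦ F y j) ?_ ?_ x x₀
  · exact (ContinuousLinearMap.proj (R := ℝ) (φ := fun _ : Fin 4 ↦ ℝ) j).contMDiff.comp hF.1
  · intro x X
    obtain ⟨q, rfl⟩ := SM.exists_base x
    obtain ⟨p, hp⟩ := SE.exists_base (SM.base q)
    obtain ⟨a, b, hab⟩ := h p q hp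
    rw [mvfderiv_coord hF, ← form22_single_eq_zero_iff, form22_mvfderiv hF hp X j hab]
    simp [form22]

lemma lift_of_liesIn {F : M → Fin 4 → ℝ} (hF : φ.IsImmersionOf F) {j : Fin 4}
    (h : LiesIn F {x | form22 x (Pi.single j 1) = 0})
    (hj : ∀ f ∈ H0, ∃ x, lift (gen j) f = vec x) {p : PE} {q : PM}
    (hpq : SE.base p = SM.base q) : ∃ a b, lift (gen j) (φ.comp p q) = vec ![a, b, 0, 0] := by
  obtain ⟨x, hx⟩ := hj _ (φ.mem_H0 p q hpq)
  obtain ⟨c, hc⟩ := h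
  have hc' : (fun y ↦ F y j) = fun _ ↦ c j := by
    funext y
    have := hc y
    rwa [Set.mem_ofPred_eq, form22_single_eq_zero_iff, Pi.sub_apply, sub_eq_zero] at this
  have key : ∀ X : TM M (SM.base q),
      form22 ![0, 0, (SM.coord q X).1, (SM.coord q X).2] x = 0 := by
    intro X
    rw [← form22_mvfderiv hF hpq X j hx, form22_single_eq_zero_iff, ← mvfderiv_coord hF, hc',
      mvfderiv_const]
    rfl
  obtain ⟨h1, h2, h3⟩ := SM.isOrthonormal (p := q) (x := SM.base q) (t := SM.vecT q)
    (s := SM.vecS q) rfl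
  have h4 : gM.inner _ (SM.vecS q) (SM.vecT q) = 0 := by rw [gM.symm, h3]
  -- Testing against e₂ and e₃ kills the two tangential coordinates.
  have k1 := key (SM.vecT q)
  have k2 := key (SM.vecS q)
  simp [SpinStructure.coord, form22, h1, h2, h3, h4] at k1 k2
  refine ⟨x 0, x 1, hx.trans (congrArg vec ?_)⟩
  funext i
  fin_cases i <;> simp [k1, k2]

variable {cov : CovariantDerivative 𝓘(ℝ, Plane) Plane E} {N : ∀ x, E x} {C : LorentzQuaternion}

lemma qderiv_comp (φ : SpinorField SE SM) {U : Set M} (s : SE.LocalFrame U) (t : SM.LocalFrame U)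
    (x : M) (X : TM M x) :
    qderiv (fun y ↦ φ.comp (s.lift y) (t.lift y)) x X =
      spinDeriv (normalForm gE cov s.timelike s.spacelike x X)
        (tangentForm gM t.timelike t.spacelike x X) (φ.comp (s.lift x) (t.lift x))
        (φ.nabla cov s t x X) := by
  rw [spinDeriv, nabla, cliff_cliff, cliff_cliff, gen_zero_mul_hat_gen_one,
    gen_two_mul_hat_gen_three, qderiv]
  abel

lemma local_coeffs (hφ : φ.IsNormalised) {U : Set M} (s : SE.LocalFrame U)
    (t : SM.LocalFrame U) {a b : M → ℝ}
    (ha : ContMDiffOn 𝓘(ℝ, Plane) 𝓘(ℝ, ℝ) ∞ a U) (hb : ContMDiffOn 𝓘(ℝ, Plane) 𝓘(ℝ, ℝ) ∞ b U)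
    (hab : ∀ y ∈ U, lift C (φ.comp (s.lift y) (t.lift y)) = vec ![a y, b y, 0, 0])
    {x : M} (hx : x ∈ U) :
    (∀ X, (φ.nabla cov s t x X * conj (φ.comp (s.lift x) (t.lift x))).re = 0) ∧
    ∀ X, (φ.nabla cov s t x X * conj (φ.comp (s.lift x) (t.lift x))).imI = 0 →
      mvfderiv 𝓘(ℝ, Plane) a x X = -(normalForm gE cov s.timelike s.spacelike x X * b x) ∧
      mvfderiv 𝓘(ℝ, Plane) b x X = -(normalForm gE cov s.timelike s.spacelike x X * a x) ∧
      a x * Complex.I *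
        (φ.nabla cov s t x X * conj (φ.comp (s.lift x) (t.lift x))).imJ.im +
      b x * (φ.nabla cov s t x X * conj (φ.comp (s.lift x) (t.lift x))).imK.re = 0 ∧
      a x * Complex.I *
        (φ.nabla cov s t x X * conj (φ.comp (s.lift x) (t.lift x))).imK.im -
      b x * (φ.nabla cov s t x X * conj (φ.comp (s.lift x) (t.lift x))).imJ.re = 0 := by
  have hUx := s.isOpen.mem_nhds hx
  have hbase : ∀ y ∈ U, SE.base (s.lift y) = SM.base (t.lift y) := fun y hy ↦ by
    rw [s.base_lift hy, t.base_lift hy]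
  have hf : MDifferentiableAt 𝓘(ℝ, Plane) 𝓘(ℝ, Fin 4 → Fin 2 → ℂ)
      (fun y ↦ toCoord (φ.comp (s.lift y) (t.lift y))) x :=
    ((φ.smooth U s t).contMDiffAt hUx).mdifferentiableAt (by simp)
  have hnorm : ∀ X, spinDeriv (normalForm gE cov s.timelike s.spacelike x X)
        (tangentForm gM t.timelike t.spacelike x X) (φ.comp (s.lift x) (t.lift x))
        (φ.nabla cov s t x X) * conj (φ.comp (s.lift x) (t.lift x)) +
      φ.comp (s.lift x) (t.lift x) * conj (spinDeriv (normalForm gE cov s.timelike s.spacelike x X)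
        (tangentForm gM t.timelike t.spacelike x X) (φ.comp (s.lift x) (t.lift x))
        (φ.nabla cov s t x X)) = 0 := by
    intro X
    rw [← qderiv_comp]
    refine (qderiv_bilin normBilin hf X).symm.trans ?_
    -- Normalisation says that f conj(f) is the constant 1.
    rw [qderiv_congr (g := fun _ ↦ 1) (Filter.eventuallyEq_of_mem hUx fun y hy ↦ ?_), qderiv_const]
    exact mul_conj_of_unit (hφ _ _ (hbase y hy))
  refine ⟨fun X ↦ mul_conj_anti (hnorm X), fun X hX ↦ ?_⟩
  refine lift_coeffs (hφ _ _ (hbase x hx)) (hab x hx) (hnorm X) ?_ hX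
  rw [← qderiv_comp, ← qderiv_vec_pair ((ha.contMDiffAt hUx).mdifferentiableAt (by simp))
    ((hb.contMDiffAt hUx).mdifferentiableAt (by simp)),
    ← qderiv_congr (Filter.eventuallyEq_of_mem hUx hab)]
  refine (qderiv_bilin (liftBilin C) hf X).trans ?_
  rw [neg_add]
  rfl

lemma local_parallel (hφ : φ.IsNormalised) (hD : φ.IsDiracSolution cov N) {U : Set M}
    (s : SE.LocalFrame U) (t : SM.LocalFrame U) {a b : M → ℝ}
    (ha : ContMDiffOn 𝓘(ℝ, Plane) 𝓘(ℝ, ℝ) ∞ a U) (hb : ContMDiffOn 𝓘(ℝ, Plane) 𝓘(ℝ, ℝ) ∞ b U)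
    (hab : ∀ y ∈ U, lift C (φ.comp (s.lift y) (t.lift y)) = vec ![a y, b y, 0, 0])
    {x : M} (hx : x ∈ U) :
    (∀ X, mvfderiv 𝓘(ℝ, Plane) a x X = -(gE.inner x (cov s.timelike x X) (s.spacelike x) * b x) ∧
      mvfderiv 𝓘(ℝ, Plane) b x X = -(gE.inner x (cov s.timelike x X) (s.spacelike x) * a x)) ∧
    a x * gE.inner x (N x) (s.timelike x) + b x * gE.inner x (N x) (s.spacelike x) = 0 := by
  obtain ⟨hre, hco⟩ := local_coeffs (cov := cov) hφ s t ha hb hab hx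
  have hbase : SE.base (s.lift x) = SM.base (t.lift x) := by rw [s.base_lift hx, t.base_lift hx]
  have hd := hD U s t x hx
  rw [repE, SE.coord_eq (s.proj_lift x hx) N, dirac] at hd
  obtain ⟨hi2, hi3, hn0, hn1⟩ := dirac_components (hre (t.timelike x)) (hre (t.spacelike x))
    (dirac_coeffs (hφ _ _ hbase) hd)
  obtain ⟨h1, h2, h3, -⟩ := hco _ hi2
  obtain ⟨h4, h5, -, h6⟩ := hco _ hi3
  constructor
  · have hON := SM.isOrthonormal (t.proj_lift x hx)
    -- The relations are known for X = e₂ and X = e₃; both sides are linear in X, so they hold for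
    -- all X.
    let L : TM M x →L[ℝ] ℝ := (gE.inner x (s.spacelike x)).comp (cov s.timelike x)
    intro X
    have hL : ∀ c : ℝ, ∀ Y, (-c • L) Y =
        -(gE.inner x (cov s.timelike x Y) (s.spacelike x) * c) := fun c Y ↦ by
      change -c * _ = _
      rw [neg_mul, mul_comm, gE.symm]
      rfl
    exact ⟨(hON.clm_ext oM (h1.trans (hL _ _).symm) (h4.trans (hL _ _).symm) X).trans (hL _ _),
      (hON.clm_ext oM (h2.trans (hL _ _).symm) (h5.trans (hL _ _).symm) X).trans (hL _ _)⟩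
  · have := form_eq_zero_of_coeffs hn0 hn1 h3 h6
    linarith

/-- If the vectors `lift C [φ]` are normal, they form a parallel section orthogonal to the mean
curvature vector. -/
theorem exists_parallel (hcov : gE.IsCompatible cov) (hφ : φ.IsNormalised)
    (hD : φ.IsDiracSolution cov N)
    (h : ∀ p q, SE.base p = SM.base q → ∃ a b, lift C (φ.comp p q) = vec ![a, b, 0, 0]) :
    ∃ ν μ : ∀ x, E x, SmoothSectionOn ν Set.univ ∧ SmoothSectionOn μ Set.univ ∧
      (∀ x, cov ν x = 0) ∧ (∀ x, cov μ x = 0) ∧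
      (∀ p q, SE.base p = SM.base q → repE SE p (ν (SE.base p)) = lift C (φ.comp p q)) ∧
      (∀ x, Hform C C = ⟨(gE.inner x (ν x) (ν x) : ℂ), 0⟩) ∧
      (∀ x, gE.inner x (μ x) (μ x) = -gE.inner x (ν x) (ν x)) ∧
      (∀ x, gE.inner x (ν x) (μ x) = 0) ∧ (∀ x, gE.inner x (N x) (ν x) = 0) := by
  set A : PE → PM → ℝ := fun p q ↦ coordZero (lift C (φ.comp p q)) with hA
  set B : PE → PM → ℝ := fun p q ↦ coordOne (lift C (φ.comp p q)) with hB
  have hAB : ∀ p q, SE.base p = SM.base q → lift C (φ.comp p q) = vec ![A p q, B p q, 0, 0] := by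
    intro p q hpq
    obtain ⟨a, b, hab⟩ := h p q hpq
    simp [hA, hB, hab, coordZero_vec, coordOne_vec]
  have hequiv : ∀ (α β : Spin11) (p : PE) (q : PM), SE.base p = SM.base q →
      A (α • p) (β • q) = Real.cosh (2 * α.param) * A p q + Real.sinh (2 * α.param) * B p q ∧
      B (α • p) (β • q) = Real.sinh (2 * α.param) * A p q + Real.cosh (2 * α.param) * B p q := by
    intro α β p q hpq
    have h1 := lift_spin C _ (hAB p q hpq) α β
    rw [← φ.equivariant α β p q hpq] at h1
    constructor
    · simpa [coordZero_vec] using congrArg coordZero h1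
    · simpa [coordOne_vec] using congrArg coordOne h1
  obtain ⟨ν, hν⟩ := exists_section SE SM A B hequiv
  -- Exchanging the coordinates respects the transformation law and the equations da = -ωb, db =
  -- -ωa, with ω the connection form of E, and gives a vector orthogonal to ν with opposite square
  -- norm.
  obtain ⟨μ, hμ⟩ := exists_section SE SM B A fun α β p q hpq ↦
    ⟨by rw [(hequiv α β p q hpq).2]; ring, by rw [(hequiv α β p q hpq).1]; ring⟩
  have hrep : ∀ p q, SE.base p = SM.base q → ∀ x (t s : E x), (SE.proj p).1 = ⟨x, (t, s)⟩ →
      ν x = A p q • t + B p q • s ∧ μ x = B p q • t + A p q • s := by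
    intro p q hpq x t s hp
    have hON := SE.isOrthonormal hp
    have h1 := hν p q hpq
    have h2 := hμ p q hpq
    rw [SE.coord_eq hp ν, Prod.mk.injEq] at h1
    rw [SE.coord_eq hp μ, Prod.mk.injEq] at h2
    constructor
    · rw [← h1.1, ← h1.2]
      exact hON.expand oE _
    · rw [← h2.1, ← h2.2]
      exact hON.expand oE _
  have hloc : ∀ x, ∃ (U : Set M) (s : SE.LocalFrame U) (t : SM.LocalFrame U), x ∈ U := by
    intro x
    obtain ⟨U₁, hx₁, ⟨s⟩⟩ := SE.exists_localFrame x
    obtain ⟨U₂, hx₂, ⟨t⟩⟩ := SM.exists_localFrame x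
    have hU := s.isOpen.inter t.isOpen
    exact ⟨U₁ ∩ U₂, s.restrict hU Set.inter_subset_left, t.restrict hU Set.inter_subset_right,
      hx₁, hx₂⟩
  have main : ∀ x, ∃ U : Set M, IsOpen U ∧ x ∈ U ∧ SmoothSectionOn ν U ∧ SmoothSectionOn μ U ∧
      cov ν x = 0 ∧ cov μ x = 0 ∧ gE.inner x (N x) (ν x) = 0 := by
    intro x
    obtain ⟨U, s, t, hx⟩ := hloc x
    have hbase : ∀ y ∈ U, SE.base (s.lift y) = SM.base (t.lift y) := fun y hy ↦ by
      rw [s.base_lift hy, t.base_lift hy]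
    have ha := contMDiffOn_bilin ((liftBilin C).compr₂ coordZero) (φ.smooth U s t)
    have hb := contMDiffOn_bilin ((liftBilin C).compr₂ coordOne) (φ.smooth U s t)
    obtain ⟨hpar, hN⟩ := local_parallel hφ hD s t ha hb
      (fun y hy ↦ hAB _ _ (hbase y hy)) hx
    have hνU := fun y hy ↦ hrep _ _ (hbase y hy) y _ _ (s.proj_lift y hy)
    have hON := fun y hy ↦ SE.isOrthonormal (s.proj_lift y hy)
    refine ⟨U, s.isOpen, hx,
      (SmoothSectionOn.combination ha hb s.smooth_timelike s.smooth_spacelike).congr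
        fun y hy ↦ (hνU y hy).1,
      (SmoothSectionOn.combination hb ha s.smooth_timelike s.smooth_spacelike).congr
        fun y hy ↦ (hνU y hy).2,
      hcov.cov_eq_zero oE s.isOpen s.smooth_timelike s.smooth_spacelike hON ha hb
        (fun y hy ↦ (hνU y hy).1) hx hpar,
      hcov.cov_eq_zero oE s.isOpen s.smooth_timelike s.smooth_spacelike hON hb ha
        (fun y hy ↦ (hνU y hy).2) hx fun X ↦ (hpar X).symm, ?_⟩
    rw [(hνU x hx).1, map_add, map_smul, map_smul]
    exact hN
  have hpt : ∀ x, Hform C C = ⟨(gE.inner x (ν x) (ν x) : ℂ), 0⟩ ∧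
      gE.inner x (μ x) (μ x) = -gE.inner x (ν x) (ν x) ∧ gE.inner x (ν x) (μ x) = 0 := by
    intro x
    obtain ⟨p, rfl⟩ := SE.exists_base x
    obtain ⟨q, hq⟩ := SM.exists_base (SE.base p)
    obtain ⟨h1, h2⟩ := hrep p q hq.symm (SE.base p) (SE.vecT p) (SE.vecS p) rfl
    obtain ⟨h3, h4, h5⟩ := SE.isOrthonormal (p := p) (x := SE.base p) (t := SE.vecT p)
      (s := SE.vecS p) rfl
    have h6 : gE.inner _ (SE.vecS p) (SE.vecT p) = 0 := by rw [gE.symm, h5]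
    have h7 := Hform_lift (hφ p q hq.symm) C
    rw [hAB p q hq.symm, Hform_vec] at h7
    rw [← h7, h1, h2]
    simp [h3, h4, h5, h6, form22]
    ring
  choose U hU hxU hs1 hs2 hc1 hc2 hn using main
  exact ⟨ν, μ, smoothSection_of_locally fun x ↦ ⟨U x, hU x, hxU x, hs1 x⟩,
    smoothSection_of_locally fun x ↦ ⟨U x, hU x, hxU x, hs2 x⟩, hc1, hc2,
    fun p q hpq ↦ by rw [repE, hν p q hpq, hAB p q hpq], fun x ↦ (hpt x).1,
    fun x ↦ (hpt x).2.1, fun x ↦ (hpt x).2.2, hn⟩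

end SpinorField

end

end LorentzSpin

end

/-! ### The characterisation of surfaces in ℝ^{1,2} and ℝ^{2,1} -/

theorem mainTheorem5 {M : Type*} [TopologicalSpace M] [ChartedSpace LorentzSpin.Plane M]
    [IsManifold 𝓘(ℝ, LorentzSpin.Plane) ∞ M] [T2Space M] [SecondCountableTopology M]
    [SimplyConnectedSpace M]
    {E : M → Type*} [TopologicalSpace (TotalSpace LorentzSpin.Plane E)]
    [∀ x, TopologicalSpace (E x)] [∀ x, AddCommGroup (E x)] [∀ x, Module ℝ (E x)]
    [∀ x, IsTopologicalAddGroup (E x)] [∀ x, ContinuousSMul ℝ (E x)]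
    [FiberBundle LorentzSpin.Plane E] [VectorBundle ℝ LorentzSpin.Plane E]
    [ContMDiffVectorBundle ∞ LorentzSpin.Plane E 𝓘(ℝ, LorentzSpin.Plane)]
    (gM : LorentzSpin.LorentzMetric (LorentzSpin.TM M)) (oM : LorentzSpin.SpaceTimeOrientation gM)
    (gE : LorentzSpin.LorentzMetric E) (oE : LorentzSpin.SpaceTimeOrientation gE)
    (cov : CovariantDerivative 𝓘(ℝ, LorentzSpin.Plane) LorentzSpin.Plane E)
    [CovariantDerivative.ContMDiffCovariantDerivative cov ∞] (hcov : gE.IsCompatible cov)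
    {PE PM : Type*} [TopologicalSpace PE] [MulAction LorentzSpin.Spin11 PE]
    [TopologicalSpace PM] [MulAction LorentzSpin.Spin11 PM]
    (SE : LorentzSpin.SpinStructure oE PE) (SM : LorentzSpin.SpinStructure oM PM)
    (N : ∀ x, E x) (hN : LorentzSpin.SmoothSectionOn N Set.univ)
    (φ : LorentzSpin.SpinorField SE SM) (hD : φ.IsDiracSolution cov N) (hφ : φ.IsNormalised)
    (F : M → Fin 4 → ℝ) (hF : φ.IsImmersionOf F) :
    (∀ e₀ e₁ : ∀ x, E x, LorentzSpin.IsParallelFrame gE cov e₀ e₁ →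
      (∃ h : M → ℝ, ∀ x, N x = h x • e₁ x) → φ.FixedBy e₀ →
      LorentzSpin.LiesIn F LorentzSpin.R12) ∧
    (∀ e₀ e₁ : ∀ x, E x, LorentzSpin.IsParallelFrame gE cov e₀ e₁ →
      (∃ h : M → ℝ, ∀ x, N x = h x • e₀ x) → φ.NegBetaBy e₁ →
      LorentzSpin.LiesIn F LorentzSpin.R21) ∧
    (LorentzSpin.LiesIn F LorentzSpin.R12 →
      ∃ e₀ e₁ : ∀ x, E x, LorentzSpin.IsParallelFrame gE cov e₀ e₁ ∧
        (∃ h : M → ℝ, ∀ x, N x = h x • e₁ x) ∧ φ.FixedBy e₀) ∧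
    (LorentzSpin.LiesIn F LorentzSpin.R21 →
      ∃ e₀ e₁ : ∀ x, E x, LorentzSpin.IsParallelFrame gE cov e₀ e₁ ∧
        (∃ h : M → ℝ, ∀ x, N x = h x • e₀ x) ∧ φ.NegBetaBy e₁) := by
  have hconn : PreconnectedSpace M := inferInstance
  have hne : Nonempty M := inferInstance
  refine ⟨fun e₀ e₁ _ _ h ↦ ?_, fun e₀ e₁ _ _ h ↦ ?_, fun h ↦ ?_, fun h ↦ ?_⟩
  · exact LorentzSpin.SpinorField.liesIn_of_lift hF (j := 0) fun p q hpq ↦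
      ⟨_, _, ((LorentzSpin.cliff_eq_self_iff (hφ p q hpq) _).1 (h p q hpq)).symm⟩
  · exact LorentzSpin.SpinorField.liesIn_of_lift hF (j := 1) fun p q hpq ↦
      ⟨_, _, ((LorentzSpin.cliff_eq_neg_beta_iff (hφ p q hpq) _).1 (h p q hpq)).symm⟩
  · obtain ⟨ν, μ, hν, hμ, cν, cμ, hrep, h0, h1, h2, hn⟩ :=
      LorentzSpin.SpinorField.exists_parallel hcov hφ hD fun p q hpq ↦
        LorentzSpin.SpinorField.lift_of_liesIn hF h
          (fun _ ↦ LorentzSpin.exists_lift_gen_zero) hpq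
    have hνν : ∀ x, gE.inner x (ν x) (ν x) = -1 := by
      intro x
      have := h0 x
      rw [LorentzSpin.gen_eq_vec, LorentzSpin.Hform_vec] at this
      have := Complex.ofReal_injective (congrArg QuadraticAlgebra.re this)
      rw [← this]
      simp [LorentzSpin.form22]
    have hON : ∀ x, gE.IsOrthonormal x (ν x) (μ x) := fun x ↦
      ⟨hνν x, by rw [h1, hνν, neg_neg], h2 x⟩
    refine ⟨ν, μ, ⟨hν, hμ, hON, cν, cμ⟩, ⟨fun x ↦ gE.inner x (N x) (μ x), fun x ↦ ?_⟩,
      fun p q hpq ↦ (LorentzSpin.cliff_eq_self_iff (hφ p q hpq) _).2 (hrep p q hpq)⟩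
    have := (hON x).expand oE (N x)
    rwa [hn, neg_zero, zero_smul, zero_add] at this
  · obtain ⟨ν, μ, hν, hμ, cν, cμ, hrep, h0, h1, h2, hn⟩ :=
      LorentzSpin.SpinorField.exists_parallel hcov hφ hD fun p q hpq ↦
        LorentzSpin.SpinorField.lift_of_liesIn hF h
          (fun _ ↦ LorentzSpin.exists_lift_gen_one) hpq
    have hνν : ∀ x, gE.inner x (ν x) (ν x) = 1 := by
      intro x
      have := h0 x
      rw [LorentzSpin.gen_eq_vec, LorentzSpin.Hform_vec] at this
      have := Complex.ofReal_injective (congrArg QuadraticAlgebra.re this)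
      rw [← this]
      simp [LorentzSpin.form22]
    -- Now ν is spacelike, so the frame is (μ, ν), and the coefficient of the timelike μ below
    -- carries a minus sign.
    have hON : ∀ x, gE.IsOrthonormal x (μ x) (ν x) := fun x ↦
      ⟨by rw [h1, hνν], hνν x, by rw [gE.symm, h2]⟩
    refine ⟨μ, ν, ⟨hμ, hν, hON, cμ, cν⟩, ⟨fun x ↦ -gE.inner x (N x) (μ x), fun x ↦ ?_⟩,
      fun p q hpq ↦ (LorentzSpin.cliff_eq_neg_beta_iff (hφ p q hpq) _).2 (hrep p q hpq)⟩
    have := (hON x).expand oE (N x)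
    rwa [hn, zero_smul, add_zero] at this
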